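/- Let $n\ge 0$ and $u\in\mathfrak S_n$. Write $s_i=(i\ i{+}1)$ $(1\le i\le n)$ for the simple transpositions of $\mathfrak S_{n+1}$, $s(1,n)=s_1s_2\cdots s_n$, and let $\mathsf h(u)\in\mathfrak S_{n+1}$ be the permutation with one-line notation $1,\,u(1)+1,\dots,u(n)+1$. For $v\le w$ in the Bruhat order of $\mathfrak S_{n+1}$ (a reduced expression of $v$ is a subword of some reduced expression of $w$) let $$\mathsf Q_{v,w}=\operatorname{Conv}\{(z(1),\dots,z(n+1))\in\mathbb R^{n+1}\mid v\le z\le w\}$$ be the Bruhat interval polytope. It lies in a hyperplane $\sum x_i=\text{const}$. Let $M=\{x\in\mathbb Z^{n+1}\mid\sum x_i=0\}$, $N=\mathbb Z^{n+1}/\mathbb Z(1,\dots,1)$, paired by the dot product. The (inner) normal fan of $\mathsf Q_{v,w}$ is the set of cones $$\{\xi\in N\otimes\mathbb R\mid \langle\xi,z-y\rangle\ge 0\text{ for all }y\in F,\ z\in \mathsf Q_{v,w}\},$$ where $F$ runs over the nonempty faces of $\mathsf Q_{v,w}$. Let $T$ be a triangulation of the convex $(n+2)$-gon with vertices labelled $0,1,\dots,n+1$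 counterclockwise. Starting with the distinguished edge $\{0,n+1\}$, proceed inductively: if $a<k<b$ are the vertices of the triangle of $T$ at a distinguished edge $\{a,b\}$ in the part of the polygon with vertices $a,a+1,\dots,b$, then put $\{a,k\}$ in the left tree and $\{k,b\}$ in the right tree of $T$, and continue with $\{a,k\}$ and $\{k,b\}$ as distinguished edges of the two remaining parts. For each $1\le k\le n$ there are a unique edge $\{k_L,k\}$ with $k_L<k$ in the left tree and a unique edge $\{k,k_R\}$ with $k<k_R$ in the right tree. With $\varpi_i\in N$ the class of $e_1+\dots+e_i$ $(0\le i\le n+1)$, put $$\mathbf v_k=\varpi_k-\varpi_{k_R},\qquad \mathbf w_k=\varpi_{k_L}-\varpi_k\qquad(1\le k\le n),$$ and let $\Sigma_T$ be the set of the cones $\operatorname{Cone}(Q)\subset N\otimes\mathbb R$, where $Q$ runs over the subsets of $\{\mathbf v_k,\mathbf w_k\mid 1\le k\le n\}$ with $\{\mathbf v_i,\mathbf w_i\}\not\subset Q$ for all $i$. The binary tree $\mathcal B_T$ of $T$ has the triangle at the edge $\{0,n+1\}$, with vertices $0<k<n+1$, as its root; its left and right subtrees are obtained in the same way from the parts of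 $T$ cut off by $\{0,k\}$ and $\{k,n+1\}$, a single edge giving the empty tree. The map $T\mapsto\mathcal B_T$ is a bijection onto the binary trees with $n$ vertices. The binary tree of a sequence of distinct integers has the smallest entry as its root, and its left and right subtrees are the binary trees of the subsequences to the left and to the right of that entry, the empty sequence giving the empty tree. Let $\psi(u)$ be the triangulation of the $(n+2)$-gon whose binary tree is the binary tree of the sequence $u(1),u(2),\dots,u(n)$. Theorem. For every $u\in\mathfrak S_n$, the normal fan of the Bruhat interval polytope $\mathsf Q_{\mathsf h(u),\,\mathsf h(u)s(1,n)}$ is equal to the fan $\Sigma_{\psi(u)}$. -/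

import Mathlib

noncomputable section

open scoped Matrix

namespace CatalanFan

/-! ## Permutations and the Bruhat order

A permutation of `{1, ..., m}` is an element of `Equiv.Perm (Fin m)`; the element `i : Fin m`
stands for the number `i + 1`. Products are compositions: `(x * y) i = x (y i)`. -/

/-- The simple transposition `s_i`, `1 ≤ i ≤ n`, of the symmetric group on `n + 1` letters. -/
def simpleTransposition {n : ℕ} (i : Fin n) : Equiv.Perm (Fin (n + 1)) :=
  Equiv.swap i.castSucc i.succ

/-- The product `s_{i_1} s_{i_2} ⋯ s_{i_l}` of a word in the simple transpositions. -/
def wordProd {n : ℕ} (l : List (Fin n)) : Equiv.Perm (Fin (n + 1)) :=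
  (l.map simpleTransposition).prod

/-- `l` is a reduced expression of `w`: its product is `w`, and no word with product `w` is
shorter. -/
def IsReducedWord {n : ℕ} (w : Equiv.Perm (Fin (n + 1))) (l : List (Fin n)) : Prop :=
  wordProd l = w ∧ ∀ l' : List (Fin n), wordProd l' = w → l.length ≤ l'.length

/-- The Bruhat order: a reduced expression of `v` is a (not necessarily contiguous) subword of a
reduced expression of `w`. -/
def BruhatLE {n : ℕ} (v w : Equiv.Perm (Fin (n + 1))) : Prop :=
  ∃ lv lw : List (Fin n), IsReducedWord v lv ∧ IsReducedWord w lw ∧ lv.Sublist lw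

/-- The permutation `1, u(1) + 1, ..., u(n) + 1` (one-line notation) on `n + 1` letters. -/
def head {n : ℕ} (u : Equiv.Perm (Fin n)) : Equiv.Perm (Fin (n + 1)) where
  toFun := Fin.cases 0 fun i => (u i).succ
  invFun := Fin.cases 0 fun i => (u.symm i).succ
  left_inv i := by induction i using Fin.cases <;> simp
  right_inv i := by induction i using Fin.cases <;> simp

/-- The permutation `s(1, n) = s_1 s_2 ⋯ s_n`. -/
def ascendingProd (n : ℕ) : Equiv.Perm (Fin (n + 1)) :=
  wordProd (List.finRange n)

/-- The point `(z(1), ..., z(n+1))` of `ℝ^(n+1)`. -/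
def permPoint {n : ℕ} (z : Equiv.Perm (Fin (n + 1))) : Fin (n + 1) → ℝ :=
  fun i => ((z i : ℕ) : ℝ) + 1

/-- The Bruhat interval polytope `Q_{v,w}`. -/
def bruhatIntervalPolytope {n : ℕ} (v w : Equiv.Perm (Fin (n + 1))) : Set (Fin (n + 1) → ℝ) :=
  convexHull ℝ {p | ∃ z, BruhatLE v z ∧ BruhatLE z w ∧ p = permPoint z}

/-! ## The spaces `M ⊗ ℝ` and `N ⊗ ℝ`, and normal fans -/

/-- `M ⊗ ℝ`: the vectors in `ℝ^(n+1)` with coordinate sum zero. -/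
def MR (n : ℕ) : Submodule ℝ (Fin (n + 1) → ℝ) where
  carrier := {x | ∑ i, x i = 0}
  add_mem' := by
    intro x y hx hy
    simp only [Set.mem_ofPred_eq] at hx hy
    simp [Finset.sum_add_distrib, hx, hy]
  zero_mem' := by simp
  smul_mem' := by
    intro c x hx
    simp only [Set.mem_ofPred_eq] at hx
    simp [← Finset.mul_sum, hx]

/-- `N ⊗ ℝ`: the quotient of `ℝ^(n+1)` by the line through `(1, ..., 1)`. -/
abbrev NR (n : ℕ) : Type :=
  (Fin (n + 1) → ℝ) ⧸ Submodule.span ℝ {(fun _ => 1 : Fin (n + 1) → ℝ)}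

/-- The image in `N ⊗ ℝ` of a vector of `ℝ^(n+1)`. -/
def toNR (n : ℕ) : (Fin (n + 1) → ℝ) →ₗ[ℝ] NR n :=
  Submodule.mkQ _

/-- The pairing of `N ⊗ ℝ` and `M ⊗ ℝ` induced by the dot product on `ℝ^(n+1)`. -/
def pairing (n : ℕ) : NR n →ₗ[ℝ] MR n →ₗ[ℝ] ℝ :=
  Submodule.liftQ _
    (LinearMap.mk₂ ℝ (fun (x : Fin (n + 1) → ℝ) (m : MR n) => x ⬝ᵥ (m : Fin (n + 1) → ℝ))
      (fun x y m => add_dotProduct x y _) (fun c x m => smul_dotProduct c x _)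
      (fun x m m' => dotProduct_add x _ _) (fun c x m => dotProduct_smul c x _))
    (by
      rw [Submodule.span_singleton_le_iff_mem, LinearMap.mem_ker]
      ext m
      have h : ∑ i, (m : Fin (n + 1) → ℝ) i = 0 := m.2
      simpa [dotProduct] using h)

@[simp]
theorem pairing_toNR (n : ℕ) (x : Fin (n + 1) → ℝ) (m : MR n) :
    pairing n (toNR n x) m = x ⬝ᵥ (m : Fin (n + 1) → ℝ) := rfl

/-- The inner normal cone in `N ⊗ ℝ` of a subset `F` (a face) of `P`: the `ξ` such that
`⟨ξ, z - y⟩ ≥ 0` for all `y ∈ F`, `z ∈ P`. It is used for sets `P` that lie in a hyperplane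
`∑ i, x i = const`, so that `z - y` is always in `M ⊗ ℝ`. -/
def normalCone {n : ℕ} (P F : Set (Fin (n + 1) → ℝ)) : PointedCone ℝ (NR n) where
  carrier := {ξ | ∀ y ∈ F, ∀ z ∈ P, ∀ h : z - y ∈ MR n, 0 ≤ pairing n ξ ⟨z - y, h⟩}
  add_mem' := by
    intro a b ha hb y hy z hz h
    have h1 := ha y hy z hz h
    have h2 := hb y hy z hz h
    simp only [map_add, LinearMap.add_apply]
    exact add_nonneg h1 h2
  zero_mem' := by
    intro y hy z hz h
    simp
  smul_mem' := by
    intro c a ha y hy z hz h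
    have h1 := ha y hy z hz h
    have h2 : pairing n (c • a) ⟨z - y, h⟩ = (c : ℝ) * pairing n a ⟨z - y, h⟩ := by
      rw [← smul_eq_mul, ← LinearMap.smul_apply, ← map_smul]
      rfl
    rw [h2]
    exact mul_nonneg c.2 h1

/-- The (inner) normal fan in `N ⊗ ℝ` of a polytope `P`: the set of the normal cones of the
nonempty faces of `P` (including `P` itself). A face is the set of points at which some linear
functional attains its maximum over `P`. -/
def normalFan {n : ℕ} (P : Set (Fin (n + 1) → ℝ)) : Set (PointedCone ℝ (NR n)) :=
  {σ | ∃ F : Set (Fin (n + 1) → ℝ), F.Nonempty ∧ IsExposed ℝ P F ∧ σ = normalCone P F}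

/-! ## Triangulations of a polygon and their fans -/

/-- A triangulation of the convex `(n+2)`-gon with vertices `0, 1, ..., n+1` in counterclockwise
order, given as the set of its edges (the boundary edges of the polygon and the diagonals used).
An edge `{a, b}` with `a < b` is the pair `(a, b)`. There are `n - 1` diagonals, hence `2 n + 1`
edges (for `n = 0` the polygon degenerates to the single edge `{0, 1}`). -/
@[ext]
structure Triangulation (n : ℕ) where
  edges : Finset (ℕ × ℕ)
  lt_and_le : ∀ a b, (a, b) ∈ edges → a < b ∧ b ≤ n + 1
  side_mem : ∀ a ≤ n, (a, a + 1) ∈ edges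
  distinguished_mem : (0, n + 1) ∈ edges
  noncrossing : ∀ a b c d, (a, b) ∈ edges → (c, d) ∈ edges → ¬ (a < c ∧ c < b ∧ b < d)
  card_edges : edges.card = 2 * n + 1

namespace Triangulation

variable {n : ℕ}

/-- `a < k < b` are the vertices of a triangle of `T`. -/
def IsTriangle (T : Triangulation n) (a k b : ℕ) : Prop :=
  a < k ∧ k < b ∧ (a, k) ∈ T.edges ∧ (k, b) ∈ T.edges ∧ (a, b) ∈ T.edges

/-- The edges `(a, b)` that occur as distinguished edge of a triangulated polygon on the vertices
`a, a + 1, ..., b` when one starts with the distinguished edge `(0, n+1)` and repeatedly removes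
the distinguished edge `(a, b)`: if `a < k < b` is the triangle at this edge, the remaining edges
`(a, k)` and `(k, b)` become the distinguished edges of the two remaining parts. -/
inductive IsDistinguished (T : Triangulation n) : ℕ → ℕ → Prop
  | base : IsDistinguished T 0 (n + 1)
  | left {a k b : ℕ} : IsDistinguished T a b → T.IsTriangle a k b → IsDistinguished T a k
  | right {a k b : ℕ} : IsDistinguished T a b → T.IsTriangle a k b → IsDistinguished T k b

/-- `{a, k}` is an edge of the left tree. -/
def IsLeftEdge (T : Triangulation n) (a k : ℕ) : Prop :=
  ∃ b, T.IsDistinguished a b ∧ T.IsTriangle a k b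

/-- `{k, b}` is an edge of the right tree. -/
def IsRightEdge (T : Triangulation n) (k b : ℕ) : Prop :=
  ∃ a, T.IsDistinguished a b ∧ T.IsTriangle a k b

end Triangulation

/-- `ϖ_i`, `0 ≤ i ≤ n + 1`: the image of `e_1 + ... + e_i` in `N`. -/
def varpi (n i : ℕ) : NR n :=
  toNR n fun j => if (j : ℕ) < i then 1 else 0

namespace Triangulation

variable {n : ℕ}

/-- `x` is the vector `v_k = ϖ_k - ϖ_b`, where `{k, b}` with `k < b` is the edge of the right tree
whose smaller vertex is `k`. -/
def IsV (T : Triangulation n) (k : ℕ) (x : NR n) : Prop :=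
  ∃ b, T.IsRightEdge k b ∧ x = varpi n k - varpi n b

/-- `x` is the vector `w_k = ϖ_a - ϖ_k`, where `{a, k}` with `a < k` is the edge of the left tree
whose larger vertex is `k`. -/
def IsW (T : Triangulation n) (k : ℕ) (x : NR n) : Prop :=
  ∃ a, T.IsLeftEdge a k ∧ x = varpi n a - varpi n k

/-- The set `{v_k, w_k | 1 ≤ k ≤ n}`. -/
def rays (T : Triangulation n) : Set (NR n) :=
  {x | ∃ k, 1 ≤ k ∧ k ≤ n ∧ (T.IsV k x ∨ T.IsW k x)}

/-- The fan `Σ_T`: the cones spanned by those subsets of `{v_k, w_k | 1 ≤ k ≤ n}` that contain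
`{v_i, w_i}` for no `i`. -/
def fan (T : Triangulation n) : Set (PointedCone ℝ (NR n)) :=
  {σ | ∃ Q : Set (NR n), Q ⊆ T.rays ∧
    (∀ i, 1 ≤ i → i ≤ n → ∀ v w, T.IsV i v → T.IsW i w → ¬ ({v, w} ⊆ Q)) ∧
    σ = PointedCone.hull ℝ Q}

end Triangulation

/-! ## Binary trees, triangulations, and the map `ψ` -/

/-- The binary tree of a sequence of numbers: the smallest entry is the root, the entries to its
left give the left subtree, the entries to its right give the right subtree. -/
def minTree (l : List ℕ) : BinaryTree Unit :=
  if h : l = [] then .nil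
  else
    .node () (minTree (l.take (l.minIdxOn id h))) (minTree (l.drop (l.minIdxOn id h + 1)))
termination_by l.length
decreasing_by
  · have := List.minIdxOn_lt_length (f := id) h
    simp only [List.length_take]
    omega
  · have := List.minIdxOn_lt_length (f := id) h
    simp only [List.length_drop]
    omega

theorem numNodes_minTree (l : List ℕ) : (minTree l).numNodes = l.length := by
  induction hn : l.length using Nat.strong_induction_on generalizing l with
  | _ m ih =>
    rw [minTree]
    split_ifs with h
    · subst h
      simpa using hn
    · have hlt := List.minIdxOn_lt_length (f := id) h
      rw [BinaryTree.numNodes, ih _ (by rw [List.length_take]; omega) _ rfl,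
        ih _ (by rw [List.length_drop]; omega) _ rfl, List.length_take, List.length_drop]
      omega

/-- The binary tree of a permutation `u`, from its one-line notation `u(1) u(2) ... u(n)`. -/
def permTree {n : ℕ} (u : Equiv.Perm (Fin n)) : BinaryTree Unit :=
  minTree (List.ofFn fun i => (u i : ℕ) + 1)

theorem numNodes_permTree {n : ℕ} (u : Equiv.Perm (Fin n)) : (permTree u).numNodes = n := by
  simp [permTree, numNodes_minTree]

/-- The binary tree `t` is obtained from the triangulated polygon on the vertices `a, ..., b`, with
distinguished edge `(a, b)`: a single edge gives the empty tree; otherwise the root is the triangle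
`a < k < b` at the distinguished edge, and the edges `(a, k)` and `(k, b)` give its left and right
subtrees. -/
inductive Triangulation.TreeAt {n : ℕ} (T : Triangulation n) : ℕ → ℕ → BinaryTree Unit → Prop
  | nil (a : ℕ) (h : a ≤ n) : TreeAt T a (a + 1) .nil
  | node {a k b : ℕ} {l r : BinaryTree Unit} (h : T.IsTriangle a k b) :
      TreeAt T a k l → TreeAt T k b r → TreeAt T a b (.node () l r)

/-- `t` is the binary tree `B_T` of the triangulation `T`. -/
def Triangulation.HasTree {n : ℕ} (T : Triangulation n) (t : BinaryTree Unit) : Prop :=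
  T.TreeAt 0 (n + 1) t

/-- The edges of the triangulation with binary tree `t` of the polygon with vertices
`a, a + 1, ..., a + t.numNodes + 1` and distinguished edge `(a, a + t.numNodes + 1)`. -/
def treeEdges : ℕ → BinaryTree Unit → Finset (ℕ × ℕ)
  | a, .nil => {(a, a + 1)}
  | a, .node _ l r =>
      insert (a, a + (l.numNodes + r.numNodes + 1) + 1)
        (treeEdges a l ∪ treeEdges (a + l.numNodes + 1) r)

theorem treeEdges_bounds (t : BinaryTree Unit) (a x y : ℕ) (h : (x, y) ∈ treeEdges a t) :
    a ≤ x ∧ x < y ∧ y ≤ a + t.numNodes + 1 := by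
  induction t generalizing a with
  | nil => simp [treeEdges] at h; simp; omega
  | node _ l r ihl ihr =>
    simp only [treeEdges, Finset.mem_insert, Finset.mem_union, Prod.mk.injEq] at h
    simp only [BinaryTree.numNodes]
    rcases h with h | h | h
    · omega
    · have := ihl _ h; omega
    · have := ihr _ h; omega

theorem treeEdges_side (t : BinaryTree Unit) (a x : ℕ) (h1 : a ≤ x)
    (h2 : x ≤ a + t.numNodes) : (x, x + 1) ∈ treeEdges a t := by
  induction t generalizing a with
  | nil => simp at h2; simp [treeEdges]; omega
  | node _ l r ihl ihr =>
    simp only [BinaryTree.numNodes] at h2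
    simp only [treeEdges, Finset.mem_insert, Finset.mem_union]
    rcases Nat.lt_or_ge (a + l.numNodes) x with h | h
    · exact Or.inr (Or.inr (ihr _ (by omega) (by omega)))
    · exact Or.inr (Or.inl (ihl _ h1 h))

theorem treeEdges_distinguished (t : BinaryTree Unit) (a : ℕ) :
    (a, a + t.numNodes + 1) ∈ treeEdges a t := by
  cases t <;> simp [treeEdges]

theorem treeEdges_noncrossing (t : BinaryTree Unit) (a x y z w : ℕ)
    (h : (x, y) ∈ treeEdges a t) (h' : (z, w) ∈ treeEdges a t) : ¬ (x < z ∧ z < y ∧ y < w) := by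
  induction t generalizing a with
  | nil => simp [treeEdges] at h h'; omega
  | node _ l r ihl ihr =>
    simp only [treeEdges, Finset.mem_insert, Finset.mem_union, Prod.mk.injEq] at h h'
    rcases h with h | h | h <;> rcases h' with h' | h' | h'
    · omega
    · have := treeEdges_bounds _ _ _ _ h'; omega
    · have := treeEdges_bounds _ _ _ _ h'; omega
    · have := treeEdges_bounds _ _ _ _ h; omega
    · exact ihl _ h h'
    · have := treeEdges_bounds _ _ _ _ h
      have := treeEdges_bounds _ _ _ _ h'
      omega
    · have := treeEdges_bounds _ _ _ _ h; omega
    · have := treeEdges_bounds _ _ _ _ h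
      have := treeEdges_bounds _ _ _ _ h'
      omega
    · exact ihr _ h h'

theorem card_treeEdges (t : BinaryTree Unit) (a : ℕ) :
    (treeEdges a t).card = 2 * t.numNodes + 1 := by
  induction t generalizing a with
  | nil => simp [treeEdges]
  | node _ l r ihl ihr =>
    rw [treeEdges, Finset.card_insert_of_notMem, Finset.card_union_of_disjoint, ihl, ihr]
    · simp only [BinaryTree.numNodes]; omega
    · rw [Finset.disjoint_left]
      rintro ⟨x, y⟩ h h'
      have := treeEdges_bounds _ _ _ _ h
      have := treeEdges_bounds _ _ _ _ h'
      omega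
    · rw [Finset.mem_union]
      rintro (h | h)
      · have := treeEdges_bounds _ _ _ _ h; omega
      · have := treeEdges_bounds _ _ _ _ h; omega

/-- The triangulation of the `(n+2)`-gon that corresponds to a binary tree with `n` vertices. -/
def treeTriangulation {n : ℕ} (t : BinaryTree Unit) (ht : t.numNodes = n) : Triangulation n where
  edges := treeEdges 0 t
  lt_and_le a b h := by have := treeEdges_bounds _ _ _ _ h; omega
  side_mem a h := treeEdges_side _ _ _ (by omega) (by omega)
  distinguished_mem := by simpa [ht] using treeEdges_distinguished t 0
  noncrossing a b c d h h' := treeEdges_noncrossing t 0 a b c d h h'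
  card_edges := by rw [card_treeEdges, ht]

theorem treeAt_of_subset {n : ℕ} (T : Triangulation n) (t : BinaryTree Unit) (a : ℕ)
    (h : treeEdges a t ⊆ T.edges) : T.TreeAt a (a + t.numNodes + 1) t := by
  induction t generalizing a with
  | nil =>
    have := T.lt_and_le a (a + 1) (h (by simp [treeEdges]))
    exact .nil a (by omega)
  | node _ l r ihl ihr =>
    simp only [treeEdges, Finset.insert_subset_iff, Finset.union_subset_iff] at h
    obtain ⟨h0, hl, hr⟩ := h
    have e : a + l.numNodes + 1 + r.numNodes + 1 = a + (l.numNodes + r.numNodes + 1) + 1 := by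
      omega
    have h2 := hr (treeEdges_distinguished r _)
    have h3 := ihr _ hr
    rw [e] at h2 h3
    rw [BinaryTree.numNodes]
    exact .node ⟨by omega, by omega, hl (treeEdges_distinguished l a), h2, h0⟩ (ihl _ hl) h3

theorem subset_of_treeAt {n : ℕ} {T : Triangulation n} {a b : ℕ} {t : BinaryTree Unit}
    (h : T.TreeAt a b t) : b = a + t.numNodes + 1 ∧ treeEdges a t ⊆ T.edges := by
  induction h with
  | nil a h => simpa [treeEdges] using T.side_mem a h
  | node h _ _ ihl ihr =>
    obtain ⟨rfl, hl⟩ := ihl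
    obtain ⟨rfl, hr⟩ := ihr
    refine ⟨by simp only [BinaryTree.numNodes]; omega, ?_⟩
    simp only [treeEdges, Finset.insert_subset_iff, Finset.union_subset_iff]
    refine ⟨?_, hl, hr⟩
    have := h.2.2.2.2
    convert this using 2
    omega

/-- The correspondence between triangulations and binary trees: `treeTriangulation t` is the unique
triangulation whose binary tree is `t`. -/
theorem hasTree_iff {n : ℕ} (T : Triangulation n) (t : BinaryTree Unit) (ht : t.numNodes = n) :
    T.HasTree t ↔ T = treeTriangulation t ht := by
  constructor
  · intro h
    have h1 := (subset_of_treeAt h).2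
    ext1
    exact (Finset.eq_of_subset_of_card_le h1 (by rw [T.card_edges, card_treeEdges, ht])).symm
  · rintro rfl
    have := treeAt_of_subset (treeTriangulation t ht) t 0 (Finset.Subset.refl _)
    simpa [Triangulation.HasTree, ht] using this

/-- The triangulation `ψ(u)` of the `(n+2)`-gon associated with a permutation `u` of `n` letters:
the triangulation whose binary tree is the binary tree of `u`. -/
def psi {n : ℕ} (u : Equiv.Perm (Fin n)) : Triangulation n :=
  treeTriangulation (permTree u) (numNodes_permTree u)

end CatalanFan

end

/-! Right multiplication by `s(1,n)` shifts the one-line notation of `v = h(u)` one step to the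
left, so the rank criterion confines the Bruhat interval from `v` to `v s(1,n)` between the partial
counts of a sequence and those of its shift. At a triangle `p < k < q` of `ψ(u)`, where `p` and `q`
are the positions of the nearest smaller entries on both sides of `k`, summing these bounds gives
the two inequalities

  `∑_{k ≤ i < q} z i ≤ ∑_{k ≤ i < q} v i`  and  `∑_{p ≤ i < k} z i ≤ ∑_{p < i ≤ k} v i`,

whose inner normals are `v_k` and `w_k`. For every choice of one of the two at each `k`, there is a
permutation in the interval at which exactly the chosen inequalities are tight: going down the
binary tree, send the smallest number still available at `k` to the one side and `v k` to the other.
Conversely, every functional is, up to a constant vector, a nonnegative combination of the normals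
of such a choice, the coefficients being the differences between its maximum over `[p, q)` and its
maxima over `[p, k)` and `[k, q)`, of which one vanishes. These two facts identify the normal fan
with the fan spanned by the choices, as for a cube. -/

noncomputable section

open scoped Matrix

namespace CatalanFan

section Words

variable {n : ℕ}

theorem simpleTransposition_mul_self (s : Fin n) :
    simpleTransposition s * simpleTransposition s = 1 :=
  Equiv.swap_mul_self _ _

theorem mul_simpleTransposition_castSucc (w : Equiv.Perm (Fin (n + 1))) (s : Fin n) :
    (w * simpleTransposition s) s.castSucc = w s.succ := by
  simp [simpleTransposition]

theorem mul_simpleTransposition_succ (w : Equiv.Perm (Fin (n + 1))) (s : Fin n) :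
    (w * simpleTransposition s) s.succ = w s.castSucc := by
  simp [simpleTransposition]

theorem apply_castSucc_ne_apply_succ (w : Equiv.Perm (Fin (n + 1))) (s : Fin n) :
    w s.castSucc ≠ w s.succ :=
  w.injective.ne s.castSucc_lt_succ.ne

theorem eq_of_simpleTransposition_lt {s : Fin n} {x y : Fin (n + 1)} (hxy : x < y)
    (h : simpleTransposition s y < simpleTransposition s x) : x = s.castSucc ∧ y = s.succ := by
  simp only [simpleTransposition, Equiv.swap_apply_def] at h
  rw [Fin.lt_def] at hxy
  split_ifs at h <;> simp only [Fin.lt_def, Fin.ext_iff, Fin.val_castSucc, Fin.val_succ] at * <;>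
    omega

theorem wordProd_cons (s : Fin n) (l : List (Fin n)) :
    wordProd (s :: l) = simpleTransposition s * wordProd l := by
  simp [wordProd]

theorem wordProd_append (l l' : List (Fin n)) :
    wordProd (l ++ l') = wordProd l * wordProd l' := by
  simp [wordProd]

theorem wordProd_concat (l : List (Fin n)) (s : Fin n) :
    wordProd (l ++ [s]) = wordProd l * simpleTransposition s := by
  simp [wordProd]

theorem exists_wordProd_eq (w : Equiv.Perm (Fin (n + 1))) : ∃ l, wordProd l = w := by
  have hw : w ∈ Submonoid.closure
      (Set.range fun s : Fin n => Equiv.swap s.castSucc s.succ) := by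
    simp [Equiv.Perm.mclosure_swap_castSucc_succ]
  induction hw using Submonoid.closure_induction with
  | mem x hx =>
    obtain ⟨s, rfl⟩ := hx
    exact ⟨[s], by simp [wordProd, simpleTransposition]⟩
  | one => exact ⟨[], rfl⟩
  | mul x y _ _ hx hy =>
    obtain ⟨l, rfl⟩ := hx
    obtain ⟨l', rfl⟩ := hy
    exact ⟨l ++ l', wordProd_append l l'⟩

theorem exists_isReducedWord (w : Equiv.Perm (Fin (n + 1))) : ∃ l, IsReducedWord w l := by
  obtain ⟨l, hl, hmin⟩ := exists_minimalFor_of_wellFoundedLT (fun l => wordProd l = w)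
    List.length (exists_wordProd_eq w)
  exact ⟨l, hl, fun l' hl' => (le_total _ _).elim id (hmin hl')⟩

/-- The exchange property. -/
theorem exists_word_of_descent {s : Fin n} {l : List (Fin n)}
    (h : wordProd l s.succ < wordProd l s.castSucc) :
    ∃ l', wordProd l' = wordProd l * simpleTransposition s ∧ l'.length + 1 = l.length := by
  induction l with
  | nil => exact absurd h s.castSucc_lt_succ.asymm
  | cons t l ih =>
    rcases (apply_castSucc_ne_apply_succ (wordProd l) s).lt_or_gt with hasc | hdesc
    · rw [wordProd_cons] at h
      obtain ⟨hx, hy⟩ := eq_of_simpleTransposition_lt hasc h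
      have hconj : simpleTransposition t =
          wordProd l * simpleTransposition s * (wordProd l)⁻¹ := by
        rw [simpleTransposition, ← hx, ← hy, simpleTransposition, Equiv.swap_apply_apply]
      refine ⟨l, ?_, rfl⟩
      rw [wordProd_cons, hconj, inv_mul_cancel_right, mul_assoc, simpleTransposition_mul_self,
        mul_one]
    · obtain ⟨l', hprod, hlen⟩ := ih hdesc
      exact ⟨t :: l', by rw [wordProd_cons, wordProd_cons, hprod, mul_assoc], by simp [hlen]⟩

theorem IsReducedWord.of_concat {w : Equiv.Perm (Fin (n + 1))} {l : List (Fin n)} {s : Fin n}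
    (h : IsReducedWord w (l ++ [s])) :
    IsReducedWord (wordProd l) l ∧ wordProd l s.castSucc < wordProd l s.succ := by
  obtain ⟨hprod, hmin⟩ := h
  rw [wordProd_concat] at hprod
  refine ⟨⟨rfl, fun l' hl' => ?_⟩, ?_⟩
  · simpa using hmin (l' ++ [s]) (by rw [wordProd_concat, hl', hprod])
  · refine (apply_castSucc_ne_apply_succ _ _).lt_or_gt.resolve_right fun hdesc => ?_
    obtain ⟨l', hprod', hlen⟩ := exists_word_of_descent hdesc
    have := hmin l' (hprod'.trans hprod)
    rw [List.length_append, List.length_singleton] at this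
    omega

theorem IsReducedWord.concat {w : Equiv.Perm (Fin (n + 1))} {l : List (Fin n)} {s : Fin n}
    (h : IsReducedWord w l) (hs : w s.castSucc < w s.succ) :
    IsReducedWord (w * simpleTransposition s) (l ++ [s]) := by
  refine ⟨by rw [wordProd_concat, h.1], fun l' hl' => ?_⟩
  obtain ⟨l'', hprod, hlen⟩ := exists_word_of_descent (s := s) (l := l') (by
    rwa [hl', mul_simpleTransposition_castSucc, mul_simpleTransposition_succ])
  rw [hl', mul_assoc, simpleTransposition_mul_self, mul_one] at hprod
  rw [List.length_append, List.length_singleton, ← hlen]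
  exact Nat.succ_le_succ (h.2 l'' hprod)

end Words

section RankCriterion

variable {n : ℕ} {v w x z : Equiv.Perm (Fin (n + 1))} {s : Fin n}

/-- The one-line notation of `z`, with values in `{0, …, n}`, extended by `0` to a sequence on
`ℕ`. -/
def oneLine (z : Equiv.Perm (Fin (n + 1))) (i : ℕ) : ℕ :=
  if h : i < n + 1 then z ⟨i, h⟩ else 0

theorem oneLine_val (z : Equiv.Perm (Fin (n + 1))) (i : Fin (n + 1)) : oneLine z i = z i :=
  dif_pos i.2

theorem oneLine_of_le (z : Equiv.Perm (Fin (n + 1))) {i : ℕ} (hi : n + 1 ≤ i) :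
    oneLine z i = 0 :=
  dif_neg hi.not_gt

theorem oneLine_val_lt_iff : oneLine z s < oneLine z (s + 1) ↔ z s.castSucc < z s.succ := by
  rw [Fin.lt_def, ← oneLine_val, ← oneLine_val, Fin.val_castSucc, Fin.val_succ]

theorem oneLine_mul_simpleTransposition (z : Equiv.Perm (Fin (n + 1))) (s : Fin n) (i : ℕ) :
    oneLine (z * simpleTransposition s) i = oneLine z (Equiv.swap (s : ℕ) (s + 1) i) := by
  rcases lt_or_ge i (n + 1) with hi | hi
  · lift i to Fin (n + 1) using hi
    have hswap : Equiv.swap (s : ℕ) (s + 1) i = (simpleTransposition s i : ℕ) :=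
      Fin.val_injective.swap_apply s.castSucc s.succ i
    rw [hswap, oneLine_val, oneLine_val, Equiv.Perm.mul_apply]
  · rw [Equiv.swap_apply_of_ne_of_ne (by omega) (by omega), oneLine_of_le _ hi,
      oneLine_of_le _ hi]

/-- The number of entries `≥ j` among the first `i` entries of the one-line notation of `z`. -/
def rank (z : Equiv.Perm (Fin (n + 1))) (i j : ℕ) : ℕ :=
  Nat.count (j ≤ oneLine z ·) i

theorem rank_zero_left (z : Equiv.Perm (Fin (n + 1))) (j : ℕ) : rank z 0 j = 0 :=
  Nat.count_zero _

theorem rank_succ_left (z : Equiv.Perm (Fin (n + 1))) (i j : ℕ) :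
    rank z (i + 1) j = rank z i j + if j ≤ oneLine z i then 1 else 0 :=
  Nat.count_succ _ _

theorem rank_eq_card (z : Equiv.Perm (Fin (n + 1))) (i j : ℕ) :
    rank z i j = ((Finset.range i).filter (j ≤ oneLine z ·)).card :=
  Nat.count_eq_card_filter_range _ _

theorem rank_mul_of_ne (z : Equiv.Perm (Fin (n + 1))) {i : ℕ} (j : ℕ) (hi : i ≠ s + 1) :
    rank (z * simpleTransposition s) i j = rank z i j := by
  rw [rank_eq_card, rank_eq_card]
  refine Finset.card_equiv (Equiv.swap (s : ℕ) (s + 1)) fun t => ?_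
  have hrange : Equiv.swap (s : ℕ) (s + 1) t < i ↔ t < i := by
    rw [Equiv.swap_apply_def]
    split_ifs <;> omega
  simp only [Finset.mem_filter, Finset.mem_range, hrange, oneLine_mul_simpleTransposition]

theorem rank_mul_succ (z : Equiv.Perm (Fin (n + 1))) (s : Fin n) (j : ℕ) :
    rank (z * simpleTransposition s) (s + 1) j =
      rank z s j + if j ≤ oneLine z (s + 1) then 1 else 0 := by
  rw [rank_succ_left, rank_mul_of_ne _ _ (by omega), oneLine_mul_simpleTransposition,
    Equiv.swap_apply_left]

/-- The entrywise order of the rank matrices, which is the Bruhat order. -/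
def RankLE (v w : Equiv.Perm (Fin (n + 1))) : Prop :=
  ∀ i j, rank v i j ≤ rank w i j

theorem RankLE.refl (w : Equiv.Perm (Fin (n + 1))) : RankLE w w := fun _ _ => le_rfl

theorem RankLE.trans (h : RankLE v w) (h' : RankLE w x) : RankLE v x :=
  fun i j => (h i j).trans (h' i j)

theorem RankLE.mul_right (h : RankLE v w) (hs : w s.castSucc < w s.succ) :
    RankLE (v * simpleTransposition s) (w * simpleTransposition s) := by
  intro i j
  by_cases hi : i = s + 1
  · have hlow := h s j
    have hhigh := h (s + 1 + 1) j
    rw [← oneLine_val_lt_iff] at hs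
    rw [hi, rank_mul_succ, rank_mul_succ]
    simp only [rank_succ_left] at hhigh
    split_ifs at hhigh ⊢ <;> omega
  · rw [rank_mul_of_ne _ _ hi, rank_mul_of_ne _ _ hi]
    exact h i j

theorem rankLE_mul_right_self (hs : w s.castSucc < w s.succ) :
    RankLE w (w * simpleTransposition s) := by
  intro i j
  by_cases hi : i = s + 1
  · rw [← oneLine_val_lt_iff] at hs
    rw [hi, rank_mul_succ, rank_succ_left]
    split_ifs <;> omega
  · rw [rank_mul_of_ne _ _ hi]

/-- The lifting property: at an ascent `s` of `v`, the rows `≠ s + 1` of the rank matrix, which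
right multiplication by `s` does not change, decide whether `v ≤ w`. -/
theorem RankLE.of_ne_succ (h : ∀ i j : ℕ, i ≠ s + 1 → rank v i j ≤ rank w i j)
    (hv : v s.castSucc < v s.succ) : RankLE v w := by
  intro i j
  by_cases hi : i = s + 1
  · have hlow := h s j (by omega)
    have hhigh := h (s + 1 + 1) j (by omega)
    rw [← oneLine_val_lt_iff] at hv
    simp only [hi, rank_succ_left] at hhigh ⊢
    split_ifs at hhigh ⊢ <;> omega
  · exact h i j hi

theorem RankLE.eq_one (h : RankLE v 1) : v = 1 := by
  have hle : ∀ i, (v i : ℕ) ≤ i := by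
    intro i
    by_contra! hi
    have hone : rank (1 : Equiv.Perm (Fin (n + 1))) (i + 1) (i + 1) = 0 := by
      rw [rank_eq_card, Finset.card_eq_zero, Finset.filter_eq_empty_iff]
      intro t ht
      rw [Finset.mem_range] at ht
      lift t to Fin (n + 1) using ht.trans_le i.2
      rw [oneLine_val, Equiv.Perm.one_apply]
      exact ht.not_ge
    have hrank := h (i + 1) (i + 1)
    rw [hone, rank_succ_left, oneLine_val, if_pos (Nat.succ_le_of_lt hi)] at hrank
    omega
  have heq := (Finset.sum_eq_sum_iff_of_le fun i _ => hle i).mp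
    (Equiv.sum_comp v fun i : Fin (n + 1) => (i : ℕ))
  exact Equiv.ext fun i => Fin.ext (heq i (Finset.mem_univ i))

theorem rankLE_of_sublist {l l' : List (Fin n)} (h : l'.Sublist l)
    (hl : IsReducedWord (wordProd l) l) : RankLE (wordProd l') (wordProd l) := by
  induction l using List.reverseRecOn generalizing l' with
  | nil => rw [List.sublist_nil.mp h]; exact .refl _
  | append_singleton l s ih =>
    obtain ⟨hl, hs⟩ := hl.of_concat
    obtain ⟨l₁, l₂, rfl, h₁, h₂⟩ := List.sublist_append_iff.mp h
    rw [wordProd_concat]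
    rcases List.sublist_singleton.mp h₂ with rfl | rfl
    · rw [List.append_nil]
      exact (ih h₁ hl).trans (rankLE_mul_right_self hs)
    · rw [wordProd_concat]
      exact (ih h₁ hl).mul_right hs

theorem RankLE.exists_sublist {l : List (Fin n)} (h : RankLE v w) (hl : IsReducedWord w l) :
    ∃ l', IsReducedWord v l' ∧ l'.Sublist l := by
  induction l using List.reverseRecOn generalizing v w with
  | nil =>
    obtain rfl : w = 1 := hl.1.symm
    exact ⟨[], h.eq_one ▸ hl, .refl _⟩
  | append_singleton l s ih =>
    obtain ⟨hl', -⟩ := hl.of_concat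
    obtain rfl : wordProd l * simpleTransposition s = w := by rw [← wordProd_concat, hl.1]
    have hrow (i j : ℕ) (hi : i ≠ s + 1) : rank v i j ≤ rank (wordProd l) i j := by
      rw [← rank_mul_of_ne (wordProd l) j hi]
      exact h i j
    rcases (apply_castSucc_ne_apply_succ v s).lt_or_gt with hasc | hdesc
    · obtain ⟨l', hv, hsub⟩ := ih (.of_ne_succ hrow hasc) hl'
      exact ⟨l', hv, hsub.trans (List.sublist_append_left _ _)⟩
    · have hasc : (v * simpleTransposition s) s.castSucc < (v * simpleTransposition s) s.succ := by
        rwa [mul_simpleTransposition_castSucc, mul_simpleTransposition_succ]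
      obtain ⟨l', hv, hsub⟩ := ih
        (.of_ne_succ (fun i j hi => (rank_mul_of_ne v j hi).trans_le (hrow i j hi)) hasc) hl'
      have hconcat := hv.concat hasc
      rw [mul_assoc, simpleTransposition_mul_self, mul_one] at hconcat
      exact ⟨l' ++ [s], hconcat, hsub.append_right _⟩

theorem bruhatLE_iff_rankLE : BruhatLE v w ↔ RankLE v w := by
  constructor
  · rintro ⟨lv, lw, ⟨rfl, -⟩, ⟨rfl, hmin⟩, hsub⟩
    exact rankLE_of_sublist hsub ⟨rfl, hmin⟩
  · intro h
    obtain ⟨lw, hw⟩ := exists_isReducedWord w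
    obtain ⟨lv, hv, hsub⟩ := h.exists_sublist hw
    exact ⟨lv, lw, hv, hw, hsub⟩

end RankCriterion

theorem ascendingProd_eq_formPerm (n : ℕ) :
    ascendingProd n = (List.finRange (n + 1)).formPerm := by
  rw [ascendingProd, wordProd, List.formPerm]
  congr 1
  exact List.ext_getElem (by simp) fun i _ _ => by simp [simpleTransposition]

theorem ascendingProd_apply_val {n : ℕ} (i : Fin (n + 1)) :
    (ascendingProd n i : ℕ) = (i + 1) % (n + 1) := by
  have h := List.formPerm_apply_getElem _ (List.nodup_finRange (n + 1)) i (by simp [i.is_le])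
  rw [List.getElem_finRange, ← ascendingProd_eq_formPerm] at h
  simpa using congrArg Fin.val h

section Basins

variable {α : Type*} [LinearOrder α] {a : ℕ → α} {p k q p' q' : ℕ}

/-- The positions `p < q` bound a part of the sequence `a` all of whose entries strictly between
them exceed both `a p` and `a q`: the interval that a vertex of the binary tree of `a` governs. -/
structure IsBasin (a : ℕ → α) (p q : ℕ) : Prop where
  lt : p < q
  left_lt : ∀ ⦃t⦄, p < t → t < q → a p < a t
  right_lt : ∀ ⦃t⦄, p < t → t < q → a q < a t

/-- The entry at `k` is the smallest one strictly between `p` and `q`, and `p`, `q` are the nearest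
positions on both sides of `k` with smaller entries; so `p < k < q` is a triangle of the
triangulation whose binary tree is that of `a`. -/
structure IsNode (a : ℕ → α) (p k q : ℕ) : Prop where
  left_lt : p < k
  lt_right : k < q
  apply_left_lt : a p < a k
  apply_right_lt : a q < a k
  apply_lt : ∀ ⦃t⦄, p < t → t < q → t ≠ k → a k < a t

/-- The last position before `k` with an entry smaller than `a k` (`0` if there is none). -/
def prevSmaller (a : ℕ → α) (k : ℕ) : ℕ :=
  sSup {p | p < k ∧ a p < a k}

/-- The first position after `k` with an entry smaller than `a k` (`0` if there is none). -/
def nextSmaller (a : ℕ → α) (k : ℕ) : ℕ :=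
  sInf {q | k < q ∧ a q < a k}

theorem IsNode.prevSmaller_eq (h : IsNode a p k q) : prevSmaller a k = p :=
  IsGreatest.csSup_eq ⟨⟨h.left_lt, h.apply_left_lt⟩, fun t ⟨htk, hat⟩ => by
    by_contra! hpt
    exact (h.apply_lt hpt (htk.trans h.lt_right) htk.ne).asymm hat⟩

theorem IsNode.nextSmaller_eq (h : IsNode a p k q) : nextSmaller a k = q :=
  IsLeast.csInf_eq ⟨⟨h.lt_right, h.apply_right_lt⟩, fun t ⟨hkt, hat⟩ => by
    by_contra! htq
    exact (h.apply_lt (h.left_lt.trans hkt) htq hkt.ne').asymm hat⟩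

theorem IsNode.isBasin_left (h : IsNode a p k q) : IsBasin a p k where
  lt := h.left_lt
  left_lt _ hpt htk := h.apply_left_lt.trans (h.apply_lt hpt (htk.trans h.lt_right) htk.ne)
  right_lt _ hpt htk := h.apply_lt hpt (htk.trans h.lt_right) htk.ne

theorem IsNode.isBasin_right (h : IsNode a p k q) : IsBasin a k q where
  lt := h.lt_right
  left_lt _ hkt htq := h.apply_lt (h.left_lt.trans hkt) htq hkt.ne'
  right_lt _ hkt htq := h.apply_right_lt.trans (h.apply_lt (h.left_lt.trans hkt) htq hkt.ne')

theorem IsBasin.le_of_isNode (h : IsBasin a p q) (hpk : p < k) (hkq : k < q)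
    (hk : IsNode a p' k q') : p ≤ p' ∧ q' ≤ q := by
  constructor <;> by_contra! hlt
  · exact (h.left_lt hpk hkq).asymm (hk.apply_lt hlt (hpk.trans hk.lt_right) hpk.ne)
  · exact (h.right_lt hpk hkq).asymm (hk.apply_lt (hk.left_lt.trans hkq) hlt hkq.ne')

theorem IsBasin.exists_isNode (h : IsBasin a p q) (ha : Set.InjOn a (Set.Ioo p q))
    (hpq : p + 1 < q) : ∃ k, IsNode a p k q := by
  obtain ⟨k, hk, hmin⟩ := (Finset.Ioo p q).exists_min_image a
    ⟨p + 1, Finset.mem_Ioo.mpr ⟨p.lt_succ_self, hpq⟩⟩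
  rw [Finset.mem_Ioo] at hk
  exact ⟨k, hk.1, hk.2, h.left_lt hk.1 hk.2, h.right_lt hk.1 hk.2, fun t hpt htq htk =>
    (hmin t (Finset.mem_Ioo.mpr ⟨hpt, htq⟩)).lt_of_ne fun heq => htk (ha ⟨hpt, htq⟩ hk heq.symm)⟩

theorem IsBasin.induction {motive : ℕ → ℕ → Prop} (h : IsBasin a p q)
    (ha : Set.InjOn a (Set.Ioo p q)) (leaf : ∀ p, motive p (p + 1))
    (node : ∀ p k q, IsNode a p k q → motive p k → motive k q → motive p q) : motive p q := by
  induction hd : q - p using Nat.strong_induction_on generalizing p q with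
  | _ d ih =>
    have hlt := h.lt
    rcases Nat.eq_or_lt_of_le (Nat.succ_le_of_lt hlt) with rfl | hpq
    · exact leaf p
    · obtain ⟨k, hk⟩ := h.exists_isNode ha hpq
      have hpk := hk.left_lt
      have hkq := hk.lt_right
      exact node p k q hk
        (ih _ (by omega) hk.isBasin_left (ha.mono (Set.Ioo_subset_Ioo_right hkq.le)) rfl)
        (ih _ (by omega) hk.isBasin_right (ha.mono (Set.Ioo_subset_Ioo_left hpk.le)) rfl)

theorem IsBasin.isNode (h : IsBasin a p q) (ha : Set.InjOn a (Set.Ioo p q)) (hpk : p < k)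
    (hkq : k < q) : IsNode a (prevSmaller a k) k (nextSmaller a k) := by
  suffices hex : p < k → k < q → ∃ p' q', IsNode a p' k q' by
    obtain ⟨p', q', hk⟩ := hex hpk hkq
    rwa [hk.prevSmaller_eq, hk.nextSmaller_eq]
  refine h.induction ha (motive := fun p q => p < k → k < q → ∃ p' q', IsNode a p' k q')
    (fun p hpk hkq => absurd hpk (Nat.le_of_lt_succ hkq).not_gt) fun p m q hm ihl ihr hpk hkq => ?_
  rcases lt_trichotomy k m with hlt | rfl | hgt
  · exact ihl hpk hlt
  · exact ⟨p, q, hm⟩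
  · exact ihr hgt hkq

end Basins

section Arcs

variable {α : Type*} [LinearOrder α] {a : ℕ → α} {p k q : ℕ}

/-- The half-open interval `[k, k_R)` or `[k_L, k)` of positions, whose negated indicator vector is
`v_k` or `w_k`; the label `(k, true)` stands for `v_k` and `(k, false)` for `w_k`. -/
def arc (a : ℕ → α) (r : ℕ × Bool) : Finset ℕ :=
  bif r.2 then Finset.Ico r.1 (nextSmaller a r.1) else Finset.Ico (prevSmaller a r.1) r.1

theorem IsNode.arc_true (h : IsNode a p k q) : arc a (k, true) = Finset.Ico k q := by
  rw [arc, h.nextSmaller_eq, cond_true]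

theorem IsNode.arc_false (h : IsNode a p k q) : arc a (k, false) = Finset.Ico p k := by
  rw [arc, h.prevSmaller_eq, cond_false]

theorem IsBasin.arc_subset (h : IsBasin a p q) (ha : Set.InjOn a (Set.Ioo p q)) (hpk : p < k)
    (hkq : k < q) (b : Bool) : arc a (k, b) ⊆ Finset.Ico p q := by
  have hk := h.isNode ha hpk hkq
  obtain ⟨hp, hq⟩ := h.le_of_isNode hpk hkq hk
  cases b
  · rw [hk.arc_false]
    exact Finset.Ico_subset_Ico hp hkq.le
  · rw [hk.arc_true]
    exact Finset.Ico_subset_Ico hpk.le hq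

theorem sum_Ioo_eq_add_add {M : Type*} [AddCommMonoid M] (f : ℕ → M) (hpk : p < k) (hkq : k < q) :
    ∑ t ∈ Finset.Ioo p q, f t =
      ∑ t ∈ Finset.Ioo p k, f t + f k + ∑ t ∈ Finset.Ioo k q, f t := by
  rw [add_assoc, Finset.add_sum_Ioo_eq_sum_Ico hkq, ← Finset.Ico_add_one_left_eq_Ioo,
    ← Finset.Ico_add_one_left_eq_Ioo]
  exact (Finset.sum_Ico_consecutive f (Nat.succ_le_of_lt hpk) hkq.le).symm

/-- The coefficient of the ray labelled `r` in the cone that contains a vector with coordinates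
`x i`: by how much the maximum of `x` drops from the interval governed by the node to its arc. -/
def arcCoeff (a : ℕ → α) (x : ℕ → ℝ) (r : ℕ × Bool) : ℝ :=
  sSup (x '' Set.Ico (prevSmaller a r.1) (nextSmaller a r.1)) - sSup (x '' arc a r)

theorem IsNode.sSup_image_eq_max (h : IsNode a p k q) (x : ℕ → ℝ) :
    sSup (x '' Set.Ico (prevSmaller a k) (nextSmaller a k)) =
      max (sSup (x '' arc a (k, false))) (sSup (x '' arc a (k, true))) := by
  rw [h.prevSmaller_eq, h.nextSmaller_eq, h.arc_false, h.arc_true, Finset.coe_Ico, Finset.coe_Ico,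
    ← Set.Ico_union_Ico_eq_Ico h.left_lt.le h.lt_right.le, Set.image_union]
  exact csSup_union
    ((Set.finite_Ico p k).image x).bddAbove ((Set.nonempty_Ico.mpr h.left_lt).image x)
    ((Set.finite_Ico k q).image x).bddAbove ((Set.nonempty_Ico.mpr h.lt_right).image x)

theorem IsNode.arcCoeff_nonneg (h : IsNode a p k q) (x : ℕ → ℝ) (b : Bool) :
    0 ≤ arcCoeff a x (k, b) := by
  rw [arcCoeff, h.sSup_image_eq_max, sub_nonneg]
  cases b
  exacts [le_max_left _ _, le_max_right _ _]

theorem IsNode.arcCoeff_eq_zero (h : IsNode a p k q) (x : ℕ → ℝ) :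
    arcCoeff a x (k, true) = 0 ∨ arcCoeff a x (k, false) = 0 := by
  simp only [arcCoeff, h.sSup_image_eq_max, sub_eq_zero, max_eq_left_iff, max_eq_right_iff]
  exact le_total _ _

theorem IsBasin.sum_arcCoeff (h : IsBasin a p q) (ha : Set.InjOn a (Set.Ioo p q)) (x : ℕ → ℝ)
    (i : ℕ) :
    ∑ k ∈ Finset.Ioo p q, ∑ b, (if i ∈ arc a (k, b) then arcCoeff a x (k, b) else 0) =
      if i ∈ Finset.Ico p q then sSup (x '' Set.Ico p q) - x i else 0 := by
  refine h.induction ha (motive := fun p q => ∑ k ∈ Finset.Ioo p q, ∑ b,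
    (if i ∈ arc a (k, b) then arcCoeff a x (k, b) else 0) =
      if i ∈ Finset.Ico p q then sSup (x '' Set.Ico p q) - x i else 0) (fun p => ?_) ?_
  · rw [Finset.Ioo_add_one_right_eq_Ioc, Finset.Ioc_self, Finset.sum_empty,
      Set.Ico_add_one_right_eq_Icc, Set.Icc_self, Set.image_singleton, csSup_singleton]
    split_ifs with hi
    · rw [show i = p by simpa using hi, sub_self]
    · rfl
  · intro p k q hk ihl ihr
    have hpk := hk.left_lt
    have hkq := hk.lt_right
    rw [sum_Ioo_eq_add_add _ hpk hkq, ihl, ihr, Fintype.sum_bool]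
    simp only [arcCoeff, hk.arc_true, hk.arc_false, hk.prevSmaller_eq, hk.nextSmaller_eq,
      Finset.mem_Ico, Finset.coe_Ico]
    split_ifs <;> first | omega | ring

end Arcs

section Corners

variable {α : Type*} [LinearOrder α] {a : ℕ → α} {ε : ℕ → Bool} {z z' : ℕ → α} {p k q p' q' i t : ℕ}
  {m : α}

/-- `z` arranges on `[p, q)` the number `m` and the entries of `a` strictly between `p` and `q` as
the choice `ε` prescribes: at every node `k` the smallest available number goes to the left half if
`ε k` holds and to the right half otherwise, and `a k` goes to the other half. These arrangements
are the vertices of the Bruhat interval polytope. -/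
inductive IsCorner (a : ℕ → α) (ε : ℕ → Bool) (z : ℕ → α) : ℕ → ℕ → α → Prop
  | leaf (p : ℕ) : IsCorner a ε z p (p + 1) (z p)
  | node {p k q : ℕ} {m : α} : IsNode a p k q → m < a k →
      IsCorner a ε z p k (bif ε k then m else a k) → IsCorner a ε z k q (bif ε k then a k else m) →
      IsCorner a ε z p q m

theorem IsCorner.congr (h : IsCorner a ε z p q m) (hz : Set.EqOn z z' (Set.Ico p q)) :
    IsCorner a ε z' p q m := by
  induction h with
  | leaf p => exact hz ⟨le_rfl, p.lt_succ_self⟩ ▸ .leaf p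
  | node hk hm _ _ ihl ihr =>
    exact .node hk hm (ihl (hz.mono (Set.Ico_subset_Ico_right hk.lt_right.le)))
      (ihr (hz.mono (Set.Ico_subset_Ico_left hk.left_lt.le)))

theorem IsBasin.exists_isCorner (h : IsBasin a p q) (ha : Set.InjOn a (Set.Ioo p q))
    (ε : ℕ → Bool) (hm : ∀ t, p < t → t < q → m < a t) : ∃ z, IsCorner a ε z p q m := by
  revert m
  refine h.induction ha (motive := fun p q => ∀ {m : α}, (∀ t, p < t → t < q → m < a t) →
    ∃ z, IsCorner a ε z p q m) (fun p m _ => ⟨fun _ => m, .leaf p⟩) ?_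
  intro p k q hk ihl ihr m hm
  have hmk := hm k hk.left_lt hk.lt_right
  obtain ⟨zl, hzl⟩ := ihl (m := bif ε k then m else a k) fun t hpt htk => by
    have := hm t hpt (htk.trans hk.lt_right)
    have := hk.isBasin_left.right_lt hpt htk
    cases ε k <;> assumption
  obtain ⟨zr, hzr⟩ := ihr (m := bif ε k then a k else m) fun t hkt htq => by
    have := hm t (hk.left_lt.trans hkt) htq
    have := hk.isBasin_right.left_lt hkt htq
    cases ε k <;> assumption
  exact ⟨fun i => if i < k then zl i else zr i, .node hk hmk
    (hzl.congr fun i hi => (if_pos hi.2).symm) (hzr.congr fun i hi => (if_neg hi.1.not_gt).symm)⟩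

theorem IsCorner.of_isNode (h : IsCorner a ε z p q m) (hpt : p < t) (htq : t < q)
    (ht : IsNode a p' t q') :
    ∃ m' < a t, IsCorner a ε z p' t (bif ε t then m' else a t) ∧
      IsCorner a ε z t q' (bif ε t then a t else m') := by
  induction h with
  | leaf p => omega
  | @node p k q m hk hm hl hr ihl ihr =>
    rcases lt_trichotomy t k with hlt | rfl | hgt
    · exact ihl hpt hlt
    · obtain rfl : p = p' := hk.prevSmaller_eq.symm.trans ht.prevSmaller_eq
      obtain rfl : q = q' := hk.nextSmaller_eq.symm.trans ht.nextSmaller_eq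
      exact ⟨m, hm, hl, hr⟩
    · exact ihr hgt htq

variable {M : Type*} [AddCommMonoid M]

theorem add_apply_bif {β : Type*} (f : β → M) (b : Bool) (x y : β) :
    f (bif b then x else y) + f (bif b then y else x) = f x + f y := by
  cases b
  exacts [add_comm _ _, rfl]

theorem sum_Ico_apply_succ {p q : ℕ} (f : ℕ → M) (hpq : p < q) :
    ∑ t ∈ Finset.Ico p q, f (t + 1) = f q + ∑ t ∈ Finset.Ioo p q, f t := by
  rw [Finset.sum_Ico_add' f, Finset.Ico_add_one_add_one_eq_Ioc, Finset.add_sum_Ioo_eq_sum_Ioc hpq]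

theorem IsCorner.sum_Ico (h : IsCorner a ε z p q m) (f : α → M) :
    ∑ i ∈ Finset.Ico p q, f (z i) = f m + ∑ t ∈ Finset.Ioo p q, f (a t) := by
  induction h with
  | leaf p =>
    rw [Finset.Ioo_add_one_right_eq_Ioc, Finset.Ioc_self, Finset.sum_empty, add_zero,
      Finset.sum_Ico_succ_top le_rfl, Finset.Ico_self, Finset.sum_empty, zero_add]
  | @node p k q m hk _ _ _ ihl ihr =>
    rw [← Finset.sum_Ico_consecutive _ hk.left_lt.le hk.lt_right.le, ihl, ihr,
      sum_Ioo_eq_add_add _ hk.left_lt hk.lt_right, add_add_add_comm, add_apply_bif]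
    abel

variable [Preorder M] [AddLeftMono M]

theorem IsCorner.add_sum_Ioo_le (h : IsCorner a ε z p q m) {f : α → M} (hf : Monotone f)
    (hpi : p < i) (hiq : i < q) :
    f m + ∑ t ∈ Finset.Ioo p i, f (a t) ≤ ∑ t ∈ Finset.Ico p i, f (z t) := by
  induction h with
  | leaf p => omega
  | @node p k q m hk hm hl hr ihl ihr =>
    have hml : m ≤ bif ε k then m else a k := by cases ε k; exacts [hm.le, le_rfl]
    rcases lt_trichotomy i k with hik | rfl | hki
    · exact (add_le_add_left (hf hml) _).trans (ihl hpi hik)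
    · rw [hl.sum_Ico]
      exact add_le_add_left (hf hml) _
    · rw [← Finset.sum_Ico_consecutive _ hk.left_lt.le hki.le, hl.sum_Ico,
        sum_Ioo_eq_add_add _ hk.left_lt hki]
      calc f m + (∑ t ∈ Finset.Ioo p k, f (a t) + f (a k) + ∑ t ∈ Finset.Ioo k i, f (a t))
          = f (bif ε k then m else a k) + ∑ t ∈ Finset.Ioo p k, f (a t) +
              (f (bif ε k then a k else m) + ∑ t ∈ Finset.Ioo k i, f (a t)) := by
            rw [add_add_add_comm, add_apply_bif]; abel
        _ ≤ _ := by gcongr; exact ihr hki hiq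

theorem IsCorner.sum_Ico_le (h : IsCorner a ε z p q m) {f : α → M} (hf : Monotone f)
    (hpi : p < i) (hiq : i < q) :
    ∑ t ∈ Finset.Ico p i, f (z t) ≤ ∑ t ∈ Finset.Ico p i, f (a (t + 1)) := by
  induction h with
  | leaf p => omega
  | @node p k q m hk hm hl hr ihl ihr =>
    have hleft : ∑ t ∈ Finset.Ico p k, f (z t) ≤ ∑ t ∈ Finset.Ico p k, f (a (t + 1)) := by
      have hml : (bif ε k then m else a k) ≤ a k := by cases ε k; exacts [le_rfl, hm.le]
      rw [hl.sum_Ico, sum_Ico_apply_succ (fun t => f (a t)) hk.left_lt]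
      exact add_le_add_left (hf hml) _
    rcases lt_trichotomy i k with hik | rfl | hki
    · exact ihl hpi hik
    · exact hleft
    · rw [← Finset.sum_Ico_consecutive _ hk.left_lt.le hki.le,
        ← Finset.sum_Ico_consecutive _ hk.left_lt.le hki.le]
      exact add_le_add hleft (ihr hki hiq)

theorem IsCorner.sum_right_eq_iff {a z : ℕ → ℕ} {m : ℕ} (h : IsCorner a ε z p q m)
    (ha : IsNode a p' t q') (hpt : p < t) (htq : t < q) :
    ∑ i ∈ Finset.Ico t q', z i = ∑ i ∈ Finset.Ico t q', a i ↔ ε t = true := by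
  obtain ⟨m', hm', -, hr⟩ := h.of_isNode hpt htq ha
  rw [hr.sum_Ico fun i => i, ← Finset.add_sum_Ioo_eq_sum_Ico ha.lt_right]
  cases ε t <;> simp [hm'.ne]

theorem IsCorner.sum_left_eq_iff {a z : ℕ → ℕ} {m : ℕ} (h : IsCorner a ε z p q m)
    (ha : IsNode a p' t q') (hpt : p < t) (htq : t < q) :
    ∑ i ∈ Finset.Ico p' t, z i = ∑ i ∈ Finset.Ico p' t, a (i + 1) ↔ ε t = false := by
  obtain ⟨m', hm', hl, -⟩ := h.of_isNode hpt htq ha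
  rw [hl.sum_Ico fun i => i, sum_Ico_apply_succ a ha.left_lt]
  cases ε t <;> simp [hm'.ne]

end Corners

section TriangulationOfSequence

variable {a : ℕ → ℕ} {p k q : ℕ}

/-- The entries of the sequence `a` strictly between the positions `p` and `q`. -/
def entriesBetween (a : ℕ → ℕ) (p q : ℕ) : List ℕ :=
  (List.range' (p + 1) (q - p - 1)).map a

theorem length_entriesBetween (a : ℕ → ℕ) (p q : ℕ) :
    (entriesBetween a p q).length = q - p - 1 := by
  simp [entriesBetween]

theorem IsNode.minTree_entriesBetween (h : IsNode a p k q) :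
    minTree (entriesBetween a p q) =
      .node () (minTree (entriesBetween a p k)) (minTree (entriesBetween a k q)) := by
  have hpk := h.left_lt
  have hkq := h.lt_right
  have hne : entriesBetween a p q ≠ [] :=
    List.ne_nil_of_length_pos (by rw [length_entriesBetween]; omega)
  have hroot : (entriesBetween a p q).minIdxOn id hne = k - p - 1 := by
    have hk : p + 1 + 1 * (k - p - 1) = k := by omega
    rw [List.minIdxOn_eq_iff]
    refine ⟨by rw [length_entriesBetween]; omega, fun j hj => ?_, fun j hj => ?_⟩ <;>
      simp only [entriesBetween, List.length_map, List.length_range', List.getElem_map,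
        List.getElem_range', id, hk] at hj ⊢
    · rcases eq_or_ne j (k - p - 1) with rfl | hjk
      · rw [hk]
      · exact (h.apply_lt (by omega) (by omega) (by omega)).le
    · exact h.apply_lt (by omega) (by omega) (by omega)
  have hdrop : p + 1 + (k - p - 1 + 1) * 1 = k + 1 := by omega
  have hlength : q - p - 1 - (k - p - 1 + 1) = q - k - 1 := by omega
  rw [minTree, dif_neg hne, hroot, entriesBetween, ← List.map_take, ← List.map_drop,
    List.take_range'_of_length_ge (by omega), List.drop_range', hdrop, hlength, entriesBetween,
    entriesBetween]

namespace Triangulation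

variable {n : ℕ} {T : Triangulation n}

theorem IsTriangle.eq_middle {k' : ℕ} (h : T.IsTriangle p k q) (h' : T.IsTriangle p k' q) :
    k = k' := by
  obtain ⟨hpk, hkq, epk, ekq, -⟩ := h
  obtain ⟨hpk', hkq', epk', ekq', -⟩ := h'
  rcases lt_trichotomy k k' with hlt | heq | hgt
  · exact absurd ⟨hpk, hlt, hkq'⟩ (T.noncrossing p k' k q epk' ekq)
  · exact heq
  · exact absurd ⟨hpk', hgt, hkq⟩ (T.noncrossing p k k' q epk ekq')

theorem TreeAt.of_isNode (hT : T.TreeAt p q (minTree (entriesBetween a p q)))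
    (hk : IsNode a p k q) :
    T.IsTriangle p k q ∧ T.TreeAt p k (minTree (entriesBetween a p k)) ∧
      T.TreeAt k q (minTree (entriesBetween a k q)) := by
  rw [hk.minTree_entriesBetween] at hT
  cases hT with
  | @node _ k' _ _ _ htri hl hr =>
    have hk' := (subset_of_treeAt hl).1
    have := hk.left_lt
    rw [numNodes_minTree, length_entriesBetween] at hk'
    obtain rfl : k' = k := by omega
    exact ⟨htri, hl, hr⟩

theorem IsTriangle.isNode (hT : T.TreeAt p q (minTree (entriesBetween a p q)))
    (h : IsBasin a p q) (ha : Set.InjOn a (Set.Ioo p q)) (htri : T.IsTriangle p k q) :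
    IsNode a p k q := by
  obtain ⟨k', hk'⟩ := h.exists_isNode ha ((Nat.succ_le_of_lt htri.1).trans_lt htri.2.1)
  rwa [htri.eq_middle (hT.of_isNode hk').1]

theorem IsDistinguished.treeAt_and_isBasin
    (hT : T.HasTree (minTree (entriesBetween a 0 (n + 1)))) (h : IsBasin a 0 (n + 1))
    (ha : Set.InjOn a (Set.Ioo 0 (n + 1))) (hpq : T.IsDistinguished p q) :
    T.TreeAt p q (minTree (entriesBetween a p q)) ∧ IsBasin a p q ∧
      Set.InjOn a (Set.Ioo p q) := by
  induction hpq with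
  | base => exact ⟨hT, h, ha⟩
  | left _ htri ih =>
    have hk := htri.isNode ih.1 ih.2.1 ih.2.2
    exact ⟨(ih.1.of_isNode hk).2.1, hk.isBasin_left,
      ih.2.2.mono (Set.Ioo_subset_Ioo_right hk.lt_right.le)⟩
  | right _ htri ih =>
    have hk := htri.isNode ih.1 ih.2.1 ih.2.2
    exact ⟨(ih.1.of_isNode hk).2.2, hk.isBasin_right,
      ih.2.2.mono (Set.Ioo_subset_Ioo_left hk.left_lt.le)⟩

theorem IsDistinguished.of_isNode {p' q' : ℕ} (hpq : T.IsDistinguished p q)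
    (hT : T.TreeAt p q (minTree (entriesBetween a p q))) (h : IsBasin a p q)
    (ha : Set.InjOn a (Set.Ioo p q)) (hpk : p < k) (hkq : k < q) (hk : IsNode a p' k q') :
    T.IsDistinguished p' q' ∧ T.IsTriangle p' k q' := by
  revert hpq hT hpk hkq
  refine h.induction ha (motive := fun p q => T.IsDistinguished p q →
    T.TreeAt p q (minTree (entriesBetween a p q)) → p < k → k < q →
      T.IsDistinguished p' q' ∧ T.IsTriangle p' k q') (fun p _ _ hpk hkq => by omega) ?_
  intro p m q hm ihl ihr hpq hT hpk hkq
  obtain ⟨htri, hTl, hTr⟩ := hT.of_isNode hm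
  rcases lt_trichotomy k m with hlt | rfl | hgt
  · exact ihl (.left hpq htri) hTl hpk hlt
  · obtain rfl : p = p' := hm.prevSmaller_eq.symm.trans hk.prevSmaller_eq
    obtain rfl : q = q' := hm.nextSmaller_eq.symm.trans hk.nextSmaller_eq
    exact ⟨hpq, htri⟩
  · exact ihr (.right hpq htri) hTr hgt hkq

theorem isDistinguished_and_isTriangle_iff
    (hT : T.HasTree (minTree (entriesBetween a 0 (n + 1)))) (h : IsBasin a 0 (n + 1))
    (ha : Set.InjOn a (Set.Ioo 0 (n + 1))) :
    T.IsDistinguished p q ∧ T.IsTriangle p k q ↔ (0 < k ∧ k < n + 1) ∧ IsNode a p k q := by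
  constructor
  · rintro ⟨hpq, htri⟩
    obtain ⟨hTpq, hbasin, hinj⟩ := hpq.treeAt_and_isBasin hT h ha
    exact ⟨⟨p.zero_le.trans_lt htri.1, htri.2.1.trans_le (T.lt_and_le p q htri.2.2.2.2).2⟩,
      htri.isNode hTpq hbasin hinj⟩
  · rintro ⟨⟨hk0, hkn⟩, hk⟩
    exact IsDistinguished.base.of_isNode hT h ha hk0 hkn hk

theorem isLeftEdge_iff (hT : T.HasTree (minTree (entriesBetween a 0 (n + 1))))
    (h : IsBasin a 0 (n + 1)) (ha : Set.InjOn a (Set.Ioo 0 (n + 1))) :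
    T.IsLeftEdge p k ↔ (0 < k ∧ k < n + 1) ∧ p = prevSmaller a k := by
  simp only [IsLeftEdge, isDistinguished_and_isTriangle_iff hT h ha, exists_and_left]
  refine and_congr_right fun hk => ⟨fun ⟨q, hq⟩ => hq.prevSmaller_eq.symm, ?_⟩
  rintro rfl
  exact ⟨_, h.isNode ha hk.1 hk.2⟩

theorem isRightEdge_iff (hT : T.HasTree (minTree (entriesBetween a 0 (n + 1))))
    (h : IsBasin a 0 (n + 1)) (ha : Set.InjOn a (Set.Ioo 0 (n + 1))) :
    T.IsRightEdge k q ↔ (0 < k ∧ k < n + 1) ∧ q = nextSmaller a k := by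
  simp only [IsRightEdge, isDistinguished_and_isTriangle_iff hT h ha, exists_and_left]
  refine and_congr_right fun hk => ⟨fun ⟨p, hp⟩ => hp.nextSmaller_eq.symm, ?_⟩
  rintro rfl
  exact ⟨_, h.isNode ha hk.1 hk.2⟩

end Triangulation
end TriangulationOfSequence

section OneLineNotation

variable {n : ℕ} {v : Equiv.Perm (Fin (n + 1))}

theorem oneLine_injOn (z : Equiv.Perm (Fin (n + 1))) : Set.InjOn (oneLine z) (Set.Iio (n + 1)) := by
  intro i hi j hj hij
  lift i to Fin (n + 1) using hi
  lift j to Fin (n + 1) using hj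
  rw [oneLine_val, oneLine_val, Fin.val_inj, z.apply_eq_iff_eq] at hij
  rw [hij]

theorem oneLine_injOn_Ioo (z : Equiv.Perm (Fin (n + 1))) :
    Set.InjOn (oneLine z) (Set.Ioo 0 (n + 1)) :=
  (oneLine_injOn z).mono Set.Ioo_subset_Iio_self

theorem sum_range_oneLine {M : Type*} [AddCommMonoid M] (z : Equiv.Perm (Fin (n + 1)))
    (f : ℕ → M) :
    ∑ i ∈ Finset.range (n + 1), f (oneLine z i) = ∑ i ∈ Finset.range (n + 1), f i := by
  rw [Finset.sum_range, Finset.sum_range]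
  simp only [oneLine_val]
  exact Equiv.sum_comp z fun i : Fin (n + 1) => f i

theorem exists_oneLine_eq {f : ℕ → ℕ}
    (h : (Multiset.range (n + 1)).map f = Multiset.range (n + 1)) :
    ∃ z : Equiv.Perm (Fin (n + 1)), Set.EqOn (oneLine z) f (Set.Iio (n + 1)) := by
  have hlt (i : Fin (n + 1)) : f i < n + 1 := by
    rw [← Multiset.mem_range, ← h]
    exact Multiset.mem_map_of_mem f (Multiset.mem_range.mpr i.2)
  have hnodup : ((Multiset.range (n + 1)).map f).Nodup := by
    rw [h]
    exact Multiset.nodup_range (n + 1)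
  have hinj : Function.Injective fun i : Fin (n + 1) => (⟨f i, hlt i⟩ : Fin (n + 1)) :=
    fun i j hij => Fin.ext <| Multiset.inj_on_of_nodup_map hnodup i (Multiset.mem_range.mpr i.2) j
      (Multiset.mem_range.mpr j.2) (Fin.mk.inj_iff.mp hij)
  exact ⟨.ofBijective _ (Finite.injective_iff_bijective.mp hinj), fun i hi => dif_pos hi⟩

theorem oneLine_zero (hv : v 0 = 0) : oneLine v 0 = 0 := by
  rw [← Fin.val_zero (n + 1), oneLine_val, hv]

theorem oneLine_pos (hv : v 0 = 0) {i : ℕ} (hi : 0 < i) (hin : i < n + 1) : 0 < oneLine v i := by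
  rw [Nat.pos_iff_ne_zero, ← oneLine_zero hv]
  exact fun h => hi.ne' (oneLine_injOn v hin n.succ_pos h)

theorem isBasin_oneLine (hv : v 0 = 0) : IsBasin (oneLine v) 0 (n + 1) where
  lt := n.succ_pos
  left_lt _ ht htn := (oneLine_zero hv).trans_lt (oneLine_pos hv ht htn)
  right_lt _ ht htn := (oneLine_of_le v le_rfl).trans_lt (oneLine_pos hv ht htn)

theorem isNode_oneLine (hv : v 0 = 0) {k : ℕ} (hk : 0 < k) (hkn : k < n + 1) :
    IsNode (oneLine v) (prevSmaller (oneLine v) k) k (nextSmaller (oneLine v) k) :=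
  (isBasin_oneLine hv).isNode (oneLine_injOn_Ioo v) hk hkn

theorem oneLine_mul_ascendingProd (hv : v 0 = 0) (i : ℕ) :
    oneLine (v * ascendingProd n) i = oneLine v (i + 1) := by
  rcases lt_trichotomy i n with hi | rfl | hi
  · lift i to Fin (n + 1) using hi.trans n.lt_succ_self
    have hc : (ascendingProd n i : ℕ) = i + 1 := by
      rw [ascendingProd_apply_val, Nat.mod_eq_of_lt (by omega)]
    rw [oneLine_val, Equiv.Perm.mul_apply, ← oneLine_val, hc]
  · have hc : (ascendingProd i (Fin.last i) : ℕ) = 0 := by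
      rw [ascendingProd_apply_val, Fin.val_last, Nat.mod_self]
    rw [oneLine_of_le v le_rfl, ← oneLine_zero hv, ← hc, oneLine_val v, ← Equiv.Perm.mul_apply,
      ← oneLine_val, Fin.val_last]
  · rw [oneLine_of_le _ hi, oneLine_of_le _ (by omega)]

theorem oneLine_head_succ {n : ℕ} (u : Equiv.Perm (Fin n)) (i : Fin n) :
    oneLine (head u) (i + 1) = u i + 1 := by
  rw [← Fin.val_succ, oneLine_val]
  rfl

theorem psi_hasTree {n : ℕ} (u : Equiv.Perm (Fin n)) :
    (psi u).HasTree (minTree (entriesBetween (oneLine (head u)) 0 (n + 1))) := by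
  have hentries : entriesBetween (oneLine (head u)) 0 (n + 1) =
      List.ofFn fun i => (u i : ℕ) + 1 := by
    refine List.ext_getElem (by simp [length_entriesBetween]) fun i h _ => ?_
    rw [length_entriesBetween] at h
    simpa [entriesBetween, add_comm] using oneLine_head_succ u ⟨i, h⟩
  rw [hentries]
  exact (hasTree_iff (psi u) (permTree u) (numNodes_permTree u)).mpr rfl

end OneLineNotation

section FacetInequalities

theorem sum_card_filter_Ioc {ι : Type*} (s : Finset ι) (f : ι → ℕ) (B : ℕ) :
    ∑ j ∈ Finset.Ioc 0 B, (s.filter (j ≤ f ·)).card = ∑ i ∈ s, min (f i) B := by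
  refine .trans (Finset.sum_card_bipartiteAbove_eq_sum_card_bipartiteBelow
    fun i j => j ≤ f i).symm (Finset.sum_congr rfl fun i _ => ?_)
  have hfilter : (Finset.Ioc 0 B).filter (· ≤ f i) = Finset.Ioc 0 (min (f i) B) := by
    ext j
    simp only [Finset.mem_filter, Finset.mem_Ioc]
    omega
  rw [Finset.bipartiteAbove, hfilter, Nat.card_Ioc, Nat.sub_zero]

theorem sum_le_sum_of_card_filter_le {ι κ : Type*} {s : Finset ι} {t : Finset κ} {f : ι → ℕ}
    {g : κ → ℕ}
    (h : ∀ j > 0, (s.filter (j ≤ f ·)).card ≤ (t.filter (j ≤ g ·)).card) :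
    ∑ i ∈ s, f i ≤ ∑ i ∈ t, g i :=
  calc ∑ i ∈ s, f i = ∑ i ∈ s, min (f i) (s.sup f) :=
        Finset.sum_congr rfl fun _ hi => (min_eq_left (Finset.le_sup hi)).symm
    _ = ∑ j ∈ Finset.Ioc 0 (s.sup f), (s.filter (j ≤ f ·)).card :=
        (sum_card_filter_Ioc s f _).symm
    _ ≤ ∑ j ∈ Finset.Ioc 0 (s.sup f), (t.filter (j ≤ g ·)).card :=
        Finset.sum_le_sum fun j hj => h j (Finset.mem_Ioc.mp hj).1
    _ = ∑ i ∈ t, min (g i) (s.sup f) := sum_card_filter_Ioc t g _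
    _ ≤ ∑ i ∈ t, g i := Finset.sum_le_sum fun _ _ => min_le_left _ _

variable {n : ℕ} {v w z : Equiv.Perm (Fin (n + 1))} {p k q : ℕ}

theorem rank_add_card_filter (z : Equiv.Perm (Fin (n + 1))) (hpq : p ≤ q) (j : ℕ) :
    rank z p j + ((Finset.Ico p q).filter (j ≤ oneLine z ·)).card = rank z q j := by
  simp only [rank_eq_card, Finset.card_filter]
  exact Finset.sum_range_add_sum_Ico _ hpq

theorem sum_oneLine_Ico_le (hpq : p ≤ q)
    (h : ∀ j > 0, (∀ i ∈ Finset.Ico p q, j ≤ oneLine w i) ∨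
      rank w p j ≤ rank z p j ∧ rank z q j ≤ rank w q j) :
    ∑ i ∈ Finset.Ico p q, oneLine z i ≤ ∑ i ∈ Finset.Ico p q, oneLine w i := by
  refine sum_le_sum_of_card_filter_le fun j hj => ?_
  rcases h j hj with hall | hrank
  · rw [Finset.filter_true_of_mem hall]
    exact Finset.card_filter_le _ _
  · have := rank_add_card_filter z hpq j
    have := rank_add_card_filter w hpq j
    omega

theorem rank_mul_ascendingProd (hv : v 0 = 0) (i : ℕ) {j : ℕ} (hj : 0 < j) :
    rank (v * ascendingProd n) i j = rank v i j + if j ≤ oneLine v i then 1 else 0 := by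
  induction i with
  | zero => rw [rank_zero_left, rank_zero_left, oneLine_zero hv, if_neg hj.not_ge]
  | succ i ih => rw [rank_succ_left, ih, rank_succ_left, oneLine_mul_ascendingProd hv]

theorem RankLE.sum_right_le (hv : v 0 = 0) (hvz : RankLE v z)
    (hzw : RankLE z (v * ascendingProd n)) (hk : IsNode (oneLine v) p k q) :
    ∑ i ∈ Finset.Ico k q, oneLine z i ≤ ∑ i ∈ Finset.Ico k q, oneLine v i := by
  refine sum_oneLine_Ico_le hk.lt_right.le fun j hj => ?_
  rcases le_or_gt j (oneLine v q) with hjq | hjq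
  · refine .inl fun i hi => ?_
    rw [Finset.mem_Ico] at hi
    rcases hi.1.eq_or_lt with rfl | hki
    exacts [hjq.trans hk.apply_right_lt.le, hjq.trans (hk.isBasin_right.right_lt hki hi.2).le]
  · refine .inr ⟨hvz k j, (hzw q j).trans_eq ?_⟩
    rw [rank_mul_ascendingProd hv q hj, if_neg hjq.not_ge, add_zero]

theorem RankLE.sum_left_le (hv : v 0 = 0) (hvz : RankLE v z)
    (hzw : RankLE z (v * ascendingProd n)) (hk : IsNode (oneLine v) p k q) :
    ∑ i ∈ Finset.Ico p k, oneLine z i ≤ ∑ i ∈ Finset.Ico p k, oneLine v (i + 1) := by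
  simp only [← oneLine_mul_ascendingProd hv]
  refine sum_oneLine_Ico_le hk.left_lt.le fun j hj => ?_
  rcases le_or_gt j (oneLine v p) with hjp | hjp
  · refine .inl fun i hi => ?_
    rw [Finset.mem_Ico] at hi
    rw [oneLine_mul_ascendingProd hv]
    rcases (Nat.succ_le_of_lt hi.2).eq_or_lt with rfl | hik
    exacts [hjp.trans hk.apply_left_lt.le,
      hjp.trans (hk.isBasin_left.left_lt (Nat.lt_succ_of_le hi.1) hik).le]
  · refine .inr ⟨?_, hzw k j⟩
    rw [rank_mul_ascendingProd hv p hj, if_neg hjp.not_ge, add_zero]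
    exact hvz p j

end FacetInequalities

section VerticesOfInterval

variable {n : ℕ} {v w z : Equiv.Perm (Fin (n + 1))} {ε : ℕ → Bool} {k : ℕ}

theorem rank_eq_sum (z : Equiv.Perm (Fin (n + 1))) (i j : ℕ) :
    rank z i j = ∑ t ∈ Finset.Ico 0 i, if j ≤ oneLine z t then 1 else 0 := by
  rw [rank_eq_card, Finset.card_filter, Finset.range_eq_Ico]

theorem monotone_ite_le (j : ℕ) : Monotone fun y : ℕ => if j ≤ y then 1 else 0 := by
  intro x y hxy
  dsimp only
  split_ifs <;> omega

theorem rank_eq_rank_of_le (v w : Equiv.Perm (Fin (n + 1))) {i : ℕ} (hi : n + 1 ≤ i) (j : ℕ) :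
    rank v i j = rank w i j := by
  have hsum (z : Equiv.Perm (Fin (n + 1))) : rank z (n + 1) j =
      ∑ y ∈ Finset.range (n + 1), if j ≤ y then 1 else 0 := by
    rw [rank_eq_sum, ← Finset.range_eq_Ico, sum_range_oneLine z fun y => if j ≤ y then 1 else 0]
  have hfilter : (Finset.Ico (n + 1) i).filter (j ≤ oneLine v ·) =
      (Finset.Ico (n + 1) i).filter (j ≤ oneLine w ·) := by
    refine Finset.filter_congr fun t ht => ?_
    rw [oneLine_of_le v (Finset.mem_Ico.mp ht).1, oneLine_of_le w (Finset.mem_Ico.mp ht).1]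
  rw [← rank_add_card_filter v hi, ← rank_add_card_filter w hi, hsum, hsum, hfilter]

theorem rankLE_of_lt (h : ∀ i j, 0 < i → i < n + 1 → rank v i j ≤ rank w i j) : RankLE v w := by
  intro i j
  rcases i.eq_zero_or_pos with rfl | hi
  · rw [rank_zero_left, rank_zero_left]
  rcases lt_or_ge i (n + 1) with hin | hin
  exacts [h i j hi hin, (rank_eq_rank_of_le v w hin j).le]

theorem IsCorner.rankLE (hv : v 0 = 0) (h : IsCorner (oneLine v) ε (oneLine z) 0 (n + 1) 0) :
    RankLE v z := by
  refine rankLE_of_lt fun i j hi hin => ?_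
  have hle := h.add_sum_Ioo_le (monotone_ite_le j) hi hin
  rwa [rank_eq_sum, rank_eq_sum, ← Finset.add_sum_Ioo_eq_sum_Ico hi, oneLine_zero hv]

theorem IsCorner.rankLE_mul_ascendingProd (hv : v 0 = 0)
    (h : IsCorner (oneLine v) ε (oneLine z) 0 (n + 1) 0) : RankLE z (v * ascendingProd n) := by
  refine rankLE_of_lt fun i j hi hin => ?_
  simp only [rank_eq_sum, oneLine_mul_ascendingProd hv]
  exact h.sum_Ico_le (monotone_ite_le j) hi hin

theorem exists_isCorner_oneLine (hv : v 0 = 0) (ε : ℕ → Bool) :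
    ∃ z : Equiv.Perm (Fin (n + 1)), IsCorner (oneLine v) ε (oneLine z) 0 (n + 1) 0 := by
  obtain ⟨f, hf⟩ := (isBasin_oneLine hv).exists_isCorner (oneLine_injOn_Ioo v) ε (m := 0)
    fun t ht htn => oneLine_pos hv ht htn
  have hvalues : (Multiset.range (n + 1)).map f = Multiset.range (n + 1) := by
    have hsum := hf.sum_Ico fun y => ({y} : Multiset ℕ)
    have hzero : ({0} : Multiset ℕ) = {oneLine v 0} := by rw [oneLine_zero hv]
    rw [hzero, Finset.add_sum_Ioo_eq_sum_Ico (f := fun t => {oneLine v t}) n.succ_pos,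
      ← Finset.range_eq_Ico, sum_range_oneLine v fun y => ({y} : Multiset ℕ),
      Finset.sum_multiset_singleton] at hsum
    rw [← Multiset.sum_map_singleton ((Multiset.range (n + 1)).map f), Multiset.map_map]
    exact hsum
  obtain ⟨z, hz⟩ := exists_oneLine_eq hvalues
  exact ⟨z, hf.congr fun i hi => (hz hi.2).symm⟩

end VerticesOfInterval

section MinimalFaces

variable {n : ℕ} {P F : Set (Fin (n + 1) → ℝ)}

/-- The face of `P` at which the functional `x ⬝ᵥ ·` is minimal. -/
def minFace (P : Set (Fin (n + 1) → ℝ)) (x : Fin (n + 1) → ℝ) : Set (Fin (n + 1) → ℝ) :=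
  {y ∈ P | ∀ z ∈ P, x ⬝ᵥ y ≤ x ⬝ᵥ z}

theorem isExposed_iff_exists_eq_minFace (hF : F.Nonempty) :
    IsExposed ℝ P F ↔ ∃ x, F = minFace P x := by
  let dual := (LinearEquiv.neg ℝ).trans
    ((dotProductEquiv ℝ (Fin (n + 1))).trans LinearMap.toContinuousLinearMap)
  have hdual (x y : Fin (n + 1) → ℝ) : dual x y = -(x ⬝ᵥ y) := neg_dotProduct x y
  rw [IsExposed, forall_prop_of_true hF, dual.surjective.exists]
  simp only [hdual, neg_le_neg_iff, minFace]

theorem toNR_mem_normalCone_iff_subset (hP : ∀ y ∈ P, ∀ z ∈ P, ∑ i, y i = ∑ i, z i) (hF : F ⊆ P)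
    (x : Fin (n + 1) → ℝ) :
    toNR n x ∈ normalCone P F ↔ F ⊆ minFace P x := by
  have hMR {y z} (hy : y ∈ F) (hz : z ∈ P) : z - y ∈ MR n := by
    change ∑ i, (z i - y i) = 0
    rw [Finset.sum_sub_distrib, hP z hz y (hF hy), sub_self]
  constructor
  · refine fun hx y hy => ⟨hF hy, fun z hz => ?_⟩
    have hpair := hx y hy z hz (hMR hy hz)
    rwa [pairing_toNR, dotProduct_sub, sub_nonneg] at hpair
  · intro hsub y hy z hz h
    rw [pairing_toNR, dotProduct_sub, sub_nonneg]
    exact (hsub hy).2 z hz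

theorem toNR_one (n : ℕ) : toNR n 1 = 0 :=
  (Submodule.Quotient.mk_eq_zero _).mpr (Submodule.mem_span_singleton_self _)

end MinimalFaces

section CubicalPolytopes

variable {n : ℕ} {ι : Type*}

/-- `Q` contains at most one of the two labels at each `k`. -/
def IsChoice (Q : Set (ι × Bool)) : Prop :=
  ∀ k, ¬ ((k, true) ∈ Q ∧ (k, false) ∈ Q)

theorem isChoice_singleton (q : ι × Bool) : IsChoice {q} := by
  rintro k ⟨rfl, h⟩
  simp at h

theorem IsChoice.exists_selector {Q : Set (ι × Bool)} (hQ : IsChoice Q) (b : Bool) :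
    ∃ ε : ι → Bool, (∀ q ∈ Q, ε q.1 = q.2) ∧ ∀ k, (k, b) ∉ Q → ε k = !b := by
  classical
  refine ⟨fun k => if (k, b) ∈ Q then b else !b, ?_, fun k hk => if_neg hk⟩
  rintro ⟨k, c⟩ hc
  have := hQ k
  cases b <;> cases c <;> simp_all

/-- The points of `P` at which the inequalities `m q ≤ g q ⬝ᵥ x` with labels in `Q` are tight. -/
def tightFace (P : Set (Fin (n + 1) → ℝ)) (g : ι × Bool → Fin (n + 1) → ℝ) (m : ι × Bool → ℝ)
    (Q : Set (ι × Bool)) : Set (Fin (n + 1) → ℝ) :=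
  {x ∈ P | ∀ q ∈ Q, g q ⬝ᵥ x = m q}

/-- A polytope `P` in a hyperplane `∑ i, x i = const` with the combinatorics of a cube and known
normal fan: its facet inequalities `m q ≤ g q ⬝ᵥ x` come in pairs of opposite ones, indexed by `ι`,
every choice of one inequality from each pair has a vertex at which exactly these are tight, and the
cones spanned by the choices cover the space. -/
structure IsCubical [Fintype ι] (P : Set (Fin (n + 1) → ℝ)) (g : ι × Bool → Fin (n + 1) → ℝ)
    (m : ι × Bool → ℝ) : Prop where
  sum_eq : ∀ y ∈ P, ∀ z ∈ P, ∑ i, y i = ∑ i, z i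
  le_dotProduct : ∀ q, ∀ x ∈ P, m q ≤ g q ⬝ᵥ x
  exists_vertex : ∀ ε : ι → Bool, ∃ x ∈ P, ∀ q, g q ⬝ᵥ x = m q ↔ ε q.1 = q.2
  exists_combination : ∀ x, ∃ (d : ℝ) (C : ι × Bool → ℝ),
    0 ≤ C ∧ IsChoice (Function.support C) ∧ x = d • 1 + ∑ q, C q • g q

namespace IsCubical

variable [Fintype ι] {P : Set (Fin (n + 1) → ℝ)} {g : ι × Bool → Fin (n + 1) → ℝ}
  {m : ι × Bool → ℝ} {Q Q' : Set (ι × Bool)} {q q' : ι × Bool}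

theorem tightFace_nonempty (h : IsCubical P g m) (hQ : IsChoice Q) :
    (tightFace P g m Q).Nonempty := by
  obtain ⟨ε, hε, -⟩ := hQ.exists_selector true
  obtain ⟨x, hx, hxε⟩ := h.exists_vertex ε
  exact ⟨x, hx, fun q hq => (hxε q).mpr (hε q hq)⟩

theorem tightFace_subset_iff (h : IsCubical P g m) (hQ : IsChoice Q) :
    tightFace P g m Q ⊆ tightFace P g m Q' ↔ Q' ⊆ Q := by
  refine ⟨fun hsub q hq => ?_, fun hsub x hx => ⟨hx.1, fun q hq => hx.2 q (hsub hq)⟩⟩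
  by_contra hqQ
  obtain ⟨ε, hε, hεq⟩ := hQ.exists_selector q.2
  obtain ⟨x, hx, hxε⟩ := h.exists_vertex ε
  have htight := (hsub ⟨hx, fun q hq => (hxε q).mpr (hε q hq)⟩).2 q hq
  rw [hxε, hεq q.1 hqQ] at htight
  exact Bool.not_ne_self _ htight

theorem minFace_combination (h : IsCubical P g m) (d : ℝ) {C : ι × Bool → ℝ} (hC : 0 ≤ C)
    (hchoice : IsChoice (Function.support C)) :
    minFace P (d • 1 + ∑ q, C q • g q) = tightFace P g m (Function.support C) := by
  have hdot (y : Fin (n + 1) → ℝ) : (d • 1 + ∑ q, C q • g q) ⬝ᵥ y =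
      d * ∑ i, y i + ∑ q, C q * (g q ⬝ᵥ y) := by
    simp only [add_dotProduct, smul_dotProduct, one_dotProduct, sum_dotProduct, smul_eq_mul]
  have hle {y} (hy : y ∈ P) (q : ι × Bool) : C q * m q ≤ C q * (g q ⬝ᵥ y) :=
    mul_le_mul_of_nonneg_left (h.le_dotProduct q y hy) (hC q)
  have htight {y} (hy : y ∈ tightFace P g m (Function.support C)) :
      ∑ q, C q * (g q ⬝ᵥ y) = ∑ q, C q * m q := by
    refine Finset.sum_congr rfl fun q _ => ?_
    rcases eq_or_ne (C q) 0 with hq | hq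
    exacts [by rw [hq, zero_mul, zero_mul], by rw [hy.2 q hq]]
  ext y
  constructor
  · rintro ⟨hy, hmin⟩
    obtain ⟨x, hx⟩ := h.tightFace_nonempty hchoice
    have hyx := hmin x hx.1
    rw [hdot, hdot, h.sum_eq y hy x hx.1, htight hx, add_le_add_iff_left] at hyx
    have heq := (Finset.sum_eq_sum_iff_of_le fun q _ => hle hy q).mp
      (hyx.antisymm' (Finset.sum_le_sum fun q _ => hle hy q))
    exact ⟨hy, fun q hq => (mul_left_cancel₀ hq (heq q (Finset.mem_univ q))).symm⟩
  · refine fun hy => ⟨hy.1, fun z hz => ?_⟩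
    rw [hdot, hdot, h.sum_eq y hy.1 z hz, htight hy, add_le_add_iff_left]
    exact Finset.sum_le_sum fun q _ => hle hz q

theorem minFace_facet (h : IsCubical P g m) (q : ι × Bool) :
    minFace P (g q) = tightFace P g m {q} := by
  classical
  have hsupp : Function.support (Pi.single q (1 : ℝ)) = {q} := Pi.support_single_of_ne one_ne_zero
  have hmin := h.minFace_combination 0 (C := Pi.single q 1) (Pi.single_nonneg.mpr zero_le_one)
    (hsupp ▸ isChoice_singleton q)
  simpa [hsupp, Pi.single_apply] using hmin

theorem toNR_mem_normalCone_iff (h : IsCubical P g m) (hQ : IsChoice Q) :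
    toNR n (g q) ∈ normalCone P (tightFace P g m Q) ↔ q ∈ Q := by
  rw [toNR_mem_normalCone_iff_subset h.sum_eq fun _ hx => hx.1, h.minFace_facet,
    h.tightFace_subset_iff hQ, Set.singleton_subset_iff]

theorem toNR_injective (h : IsCubical P g m) : Function.Injective fun q => toNR n (g q) := by
  intro q q' hqq'
  have hq := (h.toNR_mem_normalCone_iff (isChoice_singleton q)).mpr rfl
  simp only at hqq'
  rw [hqq', h.toNR_mem_normalCone_iff (isChoice_singleton q)] at hq
  exact hq.symm

theorem normalCone_tightFace (h : IsCubical P g m) (hQ : IsChoice Q) :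
    normalCone P (tightFace P g m Q) = PointedCone.hull ℝ ((fun q => toNR n (g q)) '' Q) := by
  refine le_antisymm (fun ξ hξ => ?_) ?_
  · obtain ⟨x, rfl⟩ := Submodule.mkQ_surjective _ ξ
    obtain ⟨d, C, hC, hchoice, rfl⟩ := h.exists_combination x
    change toNR n _ ∈ _ at hξ
    rw [toNR_mem_normalCone_iff_subset h.sum_eq fun _ hx => hx.1,
      h.minFace_combination d hC hchoice, h.tightFace_subset_iff hQ] at hξ
    change toNR n _ ∈ _
    rw [map_add, map_smul, toNR_one, smul_zero, zero_add, map_sum]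
    refine sum_mem fun q _ => ?_
    rw [map_smul]
    rcases eq_or_ne (C q) 0 with hq | hq
    · rw [hq, zero_smul]
      exact zero_mem _
    · exact Submodule.smul_mem _ (⟨C q, hC q⟩ : {c : ℝ // 0 ≤ c})
        (Submodule.subset_span ⟨q, hξ hq, rfl⟩)
  · rw [PointedCone.hull, Submodule.span_le]
    rintro _ ⟨q, hq, rfl⟩
    exact (h.toNR_mem_normalCone_iff hQ).mpr hq

theorem normalFan_eq_indexed (h : IsCubical P g m) :
    normalFan P =
      {σ | ∃ Q, IsChoice Q ∧ σ = PointedCone.hull ℝ ((fun q => toNR n (g q)) '' Q)} := by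
  classical
  ext σ
  constructor
  · rintro ⟨F, hF, hexp, rfl⟩
    obtain ⟨x, rfl⟩ := (isExposed_iff_exists_eq_minFace hF).mp hexp
    obtain ⟨d, C, hC, hchoice, rfl⟩ := h.exists_combination x
    exact ⟨_, hchoice, h.minFace_combination d hC hchoice ▸ h.normalCone_tightFace hchoice⟩
  · rintro ⟨Q, hQ, rfl⟩
    have hsupp : Function.support (Q.indicator (1 : ι × Bool → ℝ)) = Q := by simp
    refine ⟨_, h.tightFace_nonempty hQ, ?_, (h.normalCone_tightFace hQ).symm⟩
    rw [isExposed_iff_exists_eq_minFace (h.tightFace_nonempty hQ)]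
    have hmin := h.minFace_combination 0 (C := Q.indicator 1)
      (Set.indicator_nonneg fun _ _ => zero_le_one) (hsupp.symm ▸ hQ)
    exact ⟨_, (hsupp ▸ hmin).symm⟩

theorem normalFan_eq (h : IsCubical P g m) :
    normalFan P = {σ | ∃ Q ⊆ Set.range fun q => toNR n (g q),
      (∀ k, ¬ {toNR n (g (k, true)), toNR n (g (k, false))} ⊆ Q) ∧ σ = PointedCone.hull ℝ Q} := by
  rw [h.normalFan_eq_indexed]
  ext σ
  constructor
  · rintro ⟨Q, hQ, rfl⟩
    refine ⟨_, Set.image_subset_range _ Q, fun k hk => hQ k ?_, rfl⟩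
    rw [Set.pair_subset_iff] at hk
    exact hk.imp h.toNR_injective.mem_set_image.mp h.toNR_injective.mem_set_image.mp
  · rintro ⟨Q, hQ, hpair, rfl⟩
    refine ⟨(fun q => toNR n (g q)) ⁻¹' Q, fun k hk => hpair k (Set.pair_subset_iff.mpr hk), ?_⟩
    rw [Set.image_preimage_eq_of_subset hQ]

end IsCubical

end CubicalPolytopes

section RayVectors

variable {n : ℕ}

/-- Minus the indicator vector of the set `s` of positions. -/
def negIndicator (n : ℕ) (s : Finset ℕ) : Fin (n + 1) → ℝ :=
  fun i => if (i : ℕ) ∈ s then -1 else 0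

theorem toNR_negIndicator_Ico (n : ℕ) {p q : ℕ} (hpq : p ≤ q) :
    toNR n (negIndicator n (Finset.Ico p q)) = varpi n p - varpi n q := by
  rw [varpi, varpi, ← map_sub]
  congr 1
  ext i
  simp only [negIndicator, Finset.mem_Ico, Pi.sub_apply]
  split_ifs <;> first | omega | norm_num

theorem negIndicator_dotProduct_permPoint {s : Finset ℕ} (hs : s ⊆ Finset.range (n + 1))
    (z : Equiv.Perm (Fin (n + 1))) :
    negIndicator n s ⬝ᵥ permPoint z = -(∑ i ∈ s, oneLine z i + s.card : ℕ) := by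
  have hterm (i : Fin (n + 1)) : negIndicator n s i * permPoint z i =
      if (i : ℕ) ∈ s then -((oneLine z i : ℝ) + 1) else 0 := by
    rw [negIndicator, permPoint, oneLine_val]
    split_ifs <;> ring
  simp only [dotProduct, hterm]
  rw [← Finset.sum_range fun i => if i ∈ s then -((oneLine z i : ℝ) + 1) else 0,
    Finset.sum_ite_mem, Finset.inter_eq_right.mpr hs]
  push_cast
  rw [Finset.sum_neg_distrib, Finset.sum_add_distrib, Finset.sum_const, nsmul_eq_mul, mul_one]

theorem negIndicator_dotProduct_permPoint_le_iff {s : Finset ℕ} (hs : s ⊆ Finset.range (n + 1))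
    (w z : Equiv.Perm (Fin (n + 1))) :
    negIndicator n s ⬝ᵥ permPoint w ≤ negIndicator n s ⬝ᵥ permPoint z ↔
      ∑ i ∈ s, oneLine z i ≤ ∑ i ∈ s, oneLine w i := by
  rw [negIndicator_dotProduct_permPoint hs, negIndicator_dotProduct_permPoint hs, neg_le_neg_iff,
    Nat.cast_le, add_le_add_iff_right]

theorem negIndicator_dotProduct_permPoint_eq_iff {s : Finset ℕ} (hs : s ⊆ Finset.range (n + 1))
    (z w : Equiv.Perm (Fin (n + 1))) :
    negIndicator n s ⬝ᵥ permPoint z = negIndicator n s ⬝ᵥ permPoint w ↔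
      ∑ i ∈ s, oneLine z i = ∑ i ∈ s, oneLine w i := by
  rw [negIndicator_dotProduct_permPoint hs, negIndicator_dotProduct_permPoint hs, neg_inj,
    Nat.cast_inj, add_left_inj]

/-- The representative in `ℝ^(n+1)` of the ray `v_k` (label `(k, true)`) or `w_k` (label
`(k, false)`) of the triangulation whose binary tree is that of `a`. -/
def rayVector (n : ℕ) (a : ℕ → ℕ) (q : Finset.Ioo 0 (n + 1) × Bool) : Fin (n + 1) → ℝ :=
  negIndicator n (arc a (q.1, q.2))

variable {a : ℕ → ℕ} {T : Triangulation n}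

theorem arc_subset_range (h : IsBasin a 0 (n + 1)) (ha : Set.InjOn a (Set.Ioo 0 (n + 1)))
    (q : Finset.Ioo 0 (n + 1) × Bool) : arc a (q.1, q.2) ⊆ Finset.range (n + 1) := by
  obtain ⟨⟨k, hk⟩, b⟩ := q
  rw [Finset.mem_Ioo] at hk
  rw [Finset.range_eq_Ico]
  exact h.arc_subset ha hk.1 hk.2 b

theorem exists_eq_smul_one_add_sum_rayVector (h : IsBasin a 0 (n + 1))
    (ha : Set.InjOn a (Set.Ioo 0 (n + 1))) (x : Fin (n + 1) → ℝ) :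
    ∃ (d : ℝ) (C : Finset.Ioo 0 (n + 1) × Bool → ℝ),
      0 ≤ C ∧ IsChoice (Function.support C) ∧ x = d • 1 + ∑ q, C q • rayVector n a q := by
  let y : ℕ → ℝ := fun i => x (Fin.ofNat (n + 1) i)
  have hnode (k : Finset.Ioo 0 (n + 1)) : IsNode a (prevSmaller a k) k (nextSmaller a k) :=
    h.isNode ha (Finset.mem_Ioo.mp k.2).1 (Finset.mem_Ioo.mp k.2).2
  refine ⟨sSup (y '' Set.Ico 0 (n + 1)), fun q => arcCoeff a y (q.1, q.2),
    fun q => (hnode q.1).arcCoeff_nonneg y q.2, fun k hk => ?_, ?_⟩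
  · exact ((hnode k).arcCoeff_eq_zero y).elim hk.1 hk.2
  · ext i
    have hsum := h.sum_arcCoeff ha y i
    rw [if_pos (Finset.mem_Ico.mpr ⟨i.val.zero_le, i.2⟩), ← Finset.sum_coe_sort,
      ← Fintype.sum_prod_type' fun (k : Finset.Ioo 0 (n + 1)) b =>
        if (i : ℕ) ∈ arc a (k, b) then arcCoeff a y (k, b) else 0] at hsum
    have hneg (q : Finset.Ioo 0 (n + 1) × Bool) : arcCoeff a y (q.1, q.2) * rayVector n a q i =
        -(if (i : ℕ) ∈ arc a (q.1, q.2) then arcCoeff a y (q.1, q.2) else 0) := by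
      rw [rayVector, negIndicator]
      split_ifs <;> ring
    simp only [Pi.add_apply, Pi.smul_apply, Pi.one_apply, Finset.sum_apply, smul_eq_mul, mul_one,
      hneg, Finset.sum_neg_distrib, hsum]
    simp [y]

namespace Triangulation

theorem isV_iff (hT : T.HasTree (minTree (entriesBetween a 0 (n + 1)))) (h : IsBasin a 0 (n + 1))
    (ha : Set.InjOn a (Set.Ioo 0 (n + 1))) {k : ℕ} {x : NR n} :
    T.IsV k x ↔ ∃ hk, x = toNR n (rayVector n a (⟨k, hk⟩, true)) := by
  have hvector (hk : 0 < k ∧ k < n + 1) := (h.isNode ha hk.1 hk.2).arc_true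
  have hlt (hk : 0 < k ∧ k < n + 1) := (h.isNode ha hk.1 hk.2).lt_right.le
  simp only [IsV, isRightEdge_iff hT h ha, and_assoc, rayVector, Finset.mem_Ioo]
  constructor
  · rintro ⟨_, h0k, hkn, rfl, rfl⟩
    exact ⟨⟨h0k, hkn⟩, by rw [hvector ⟨h0k, hkn⟩, toNR_negIndicator_Ico n (hlt ⟨h0k, hkn⟩)]⟩
  · rintro ⟨hk, rfl⟩
    exact ⟨_, hk.1, hk.2, rfl, by rw [hvector hk, toNR_negIndicator_Ico n (hlt hk)]⟩

theorem isW_iff (hT : T.HasTree (minTree (entriesBetween a 0 (n + 1)))) (h : IsBasin a 0 (n + 1))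
    (ha : Set.InjOn a (Set.Ioo 0 (n + 1))) {k : ℕ} {x : NR n} :
    T.IsW k x ↔ ∃ hk, x = toNR n (rayVector n a (⟨k, hk⟩, false)) := by
  have hvector (hk : 0 < k ∧ k < n + 1) := (h.isNode ha hk.1 hk.2).arc_false
  have hlt (hk : 0 < k ∧ k < n + 1) := (h.isNode ha hk.1 hk.2).left_lt.le
  simp only [IsW, isLeftEdge_iff hT h ha, and_assoc, rayVector, Finset.mem_Ioo]
  constructor
  · rintro ⟨_, h0k, hkn, rfl, rfl⟩
    exact ⟨⟨h0k, hkn⟩, by rw [hvector ⟨h0k, hkn⟩, toNR_negIndicator_Ico n (hlt ⟨h0k, hkn⟩)]⟩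
  · rintro ⟨hk, rfl⟩
    exact ⟨_, hk.1, hk.2, rfl, by rw [hvector hk, toNR_negIndicator_Ico n (hlt hk)]⟩

theorem rays_eq_range (hT : T.HasTree (minTree (entriesBetween a 0 (n + 1))))
    (h : IsBasin a 0 (n + 1)) (ha : Set.InjOn a (Set.Ioo 0 (n + 1))) :
    T.rays = Set.range fun q => toNR n (rayVector n a q) := by
  ext x
  simp only [rays, isV_iff hT h ha, isW_iff hT h ha]
  constructor
  · rintro ⟨k, -, -, ⟨hk, rfl⟩ | ⟨hk, rfl⟩⟩
    exacts [⟨(⟨k, hk⟩, true), rfl⟩, ⟨(⟨k, hk⟩, false), rfl⟩]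
  · rintro ⟨⟨⟨k, hk⟩, b⟩, rfl⟩
    have hkn := Finset.mem_Ioo.mp hk
    refine ⟨k, hkn.1, Nat.lt_succ_iff.mp hkn.2, ?_⟩
    cases b
    exacts [Or.inr ⟨hk, rfl⟩, Or.inl ⟨hk, rfl⟩]

theorem fan_eq (hT : T.HasTree (minTree (entriesBetween a 0 (n + 1)))) (h : IsBasin a 0 (n + 1))
    (ha : Set.InjOn a (Set.Ioo 0 (n + 1))) :
    T.fan = {σ | ∃ Q ⊆ Set.range fun q => toNR n (rayVector n a q),
      (∀ k, ¬ {toNR n (rayVector n a (k, true)), toNR n (rayVector n a (k, false))} ⊆ Q) ∧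
        σ = PointedCone.hull ℝ Q} := by
  simp only [fan, rays_eq_range hT h ha, isV_iff hT h ha, isW_iff hT h ha]
  ext σ
  refine exists_congr fun Q => and_congr_right fun _ => and_congr_left fun _ => ⟨?_, ?_⟩
  · rintro hQ ⟨k, hk⟩
    have hkn := Finset.mem_Ioo.mp hk
    exact hQ k hkn.1 (Nat.lt_succ_iff.mp hkn.2) _ _ ⟨hk, rfl⟩ ⟨hk, rfl⟩
  · rintro hQ k - - _ _ ⟨hk, rfl⟩ ⟨_, rfl⟩
    exact hQ ⟨k, hk⟩

end Triangulation

end RayVectors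

section BruhatIntervalPolytopes

variable {n : ℕ} {v : Equiv.Perm (Fin (n + 1))}

theorem sum_permPoint (z : Equiv.Perm (Fin (n + 1))) :
    ∑ i, permPoint z i = ∑ i : Fin (n + 1), ((i : ℝ) + 1) :=
  Equiv.sum_comp z fun i : Fin (n + 1) => (i : ℝ) + 1

theorem le_dotProduct_of_mem_bruhatIntervalPolytope {w : Equiv.Perm (Fin (n + 1))}
    {g x : Fin (n + 1) → ℝ} {c : ℝ}
    (hg : ∀ z, BruhatLE v z → BruhatLE z w → c ≤ g ⬝ᵥ permPoint z)
    (hx : x ∈ bruhatIntervalPolytope v w) : c ≤ g ⬝ᵥ x := by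
  have hconvex : Convex ℝ {x | c ≤ g ⬝ᵥ x} :=
    convex_halfSpace_ge (dotProductEquiv ℝ (Fin (n + 1)) g).isLinear c
  refine convexHull_min ?_ hconvex hx
  rintro _ ⟨z, hvz, hzw, rfl⟩
  exact hg z hvz hzw

theorem sum_eq_of_mem_bruhatIntervalPolytope {w : Equiv.Perm (Fin (n + 1))}
    {x : Fin (n + 1) → ℝ} (hx : x ∈ bruhatIntervalPolytope v w) :
    ∑ i, x i = ∑ i : Fin (n + 1), ((i : ℝ) + 1) := by
  have hconvex : Convex ℝ {x : Fin (n + 1) → ℝ | 1 ⬝ᵥ x = ∑ i : Fin (n + 1), ((i : ℝ) + 1)} :=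
    convex_hyperplane (dotProductEquiv ℝ (Fin (n + 1)) 1).isLinear _
  rw [← one_dotProduct]
  refine convexHull_min ?_ hconvex hx
  rintro _ ⟨z, -, -, rfl⟩
  exact (one_dotProduct _).trans (sum_permPoint z)

/-- The endpoint of the Bruhat interval that lies on every facet with a label `(k, b)`. -/
def facetVertex (v : Equiv.Perm (Fin (n + 1))) : Bool → Equiv.Perm (Fin (n + 1))
  | true => v
  | false => v * ascendingProd n

theorem isCubical_bruhatIntervalPolytope (hv : v 0 = 0) :
    IsCubical (bruhatIntervalPolytope v (v * ascendingProd n)) (rayVector n (oneLine v))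
      fun q => rayVector n (oneLine v) q ⬝ᵥ permPoint (facetVertex v q.2) := by
  have hbasin := isBasin_oneLine hv
  have hinj := oneLine_injOn_Ioo v
  have hrange := arc_subset_range hbasin hinj
  have hnode {k : ℕ} (hk : 0 < k ∧ k < n + 1) := isNode_oneLine hv hk.1 hk.2
  constructor
  case sum_eq =>
    exact fun y hy z hz => (sum_eq_of_mem_bruhatIntervalPolytope hy).trans
      (sum_eq_of_mem_bruhatIntervalPolytope hz).symm
  case le_dotProduct =>
    refine fun q x hx => le_dotProduct_of_mem_bruhatIntervalPolytope (fun z hvz hzw => ?_) hx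
    rw [bruhatLE_iff_rankLE] at hvz hzw
    rw [rayVector, negIndicator_dotProduct_permPoint_le_iff (hrange q)]
    obtain ⟨⟨k, hk⟩, _ | _⟩ := q <;> rw [Finset.mem_Ioo] at hk
    · simp only [(hnode hk).arc_false, facetVertex, oneLine_mul_ascendingProd hv]
      exact hvz.sum_left_le hv hzw (hnode hk)
    · rw [(hnode hk).arc_true]
      exact hvz.sum_right_le hv hzw (hnode hk)
  case exists_vertex =>
    intro ε
    have hval : Function.Injective ((↑) : Finset.Ioo 0 (n + 1) → ℕ) := Subtype.val_injective
    obtain ⟨ε', rfl⟩ := hval.surjective_comp_right ε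
    obtain ⟨z, hz⟩ := exists_isCorner_oneLine hv ε'
    refine ⟨permPoint z, subset_convexHull ℝ _ ⟨z, bruhatLE_iff_rankLE.mpr (hz.rankLE hv),
      bruhatLE_iff_rankLE.mpr (hz.rankLE_mul_ascendingProd hv), rfl⟩, fun q => ?_⟩
    rw [rayVector, negIndicator_dotProduct_permPoint_eq_iff (hrange q)]
    obtain ⟨⟨k, hk⟩, _ | _⟩ := q <;> rw [Finset.mem_Ioo] at hk
    · simp only [(hnode hk).arc_false, facetVertex, oneLine_mul_ascendingProd hv]
      exact hz.sum_left_eq_iff (hnode hk) hk.1 hk.2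
    · rw [(hnode hk).arc_true]
      exact hz.sum_right_eq_iff (hnode hk) hk.1 hk.2
  case exists_combination => exact exists_eq_smul_one_add_sum_rayVector hbasin hinj

end BruhatIntervalPolytopes

end CatalanFan

end

theorem theorem6p4 (n : ℕ) (u : Equiv.Perm (Fin n)) :
    CatalanFan.normalFan
        (CatalanFan.bruhatIntervalPolytope (CatalanFan.head u)
          (CatalanFan.head u * CatalanFan.ascendingProd n)) =
      (CatalanFan.psi u).fan := by
  have hv : CatalanFan.head u 0 = 0 := rfl
  rw [(CatalanFan.isCubical_bruhatIntervalPolytope hv).normalFan_eq,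
    CatalanFan.Triangulation.fan_eq (CatalanFan.psi_hasTree u) (CatalanFan.isBasin_oneLine hv)
      (CatalanFan.oneLine_injOn_Ioo _)]
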